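/- Let $\sigma=\{\sigma_z\}_{z\in\mathbb Z}$ be i.i.d. strictly positive random variables with law $\mathbf P$, and suppose that $L(x):=1/\mathbf P(\sigma_0>x)$ is slowly varying at infinity, i.e. $\mathbf P(\sigma_0>x)>0$ for all $x$ and $\lim_{u\to\infty}L(uv)/L(u)=1$ for every $v>0$. For fixed $\sigma$, let $\{X_s\}_{s\ge0}$ be the Bouchaud trap model in the trapping landscape $\sigma$: the continuous-time Markov chain on $\mathbb Z$ with $X_0=0$ that jumps from $z$ to each of $z-1$ and $z+1$ at rate $1/(2\sigma_z)$ (so at each visit to $z$ it waits an independent exponential time of mean $\sigma_z$ and then moves to a uniformly chosen neighbour); let $P_\sigma$ denote its law. For $t\ge0$ put \[ \ell_t:=\min\{s\ge0: s\,L(s)\ge t\},\qquad Z_t^{(1)}:=\min\{z\in\mathbb Z: z>0,\ \sigma_z>\ell_t\},\qquad Z_t^{(2)}:=\max\{z\in\mathbb Z: z<0,\ \sigma_z>\ell_t\}, \] and $\Gamma_t:=\{Z_t^{(1)},Z_t^{(2)}\}$ (the two sites exist $\mathbf P$-almost surely). Then, for $i=1,2$, as $t\to\infty$, \[ P_\sigma\bigl(X_t=Z_t^{(i)}\bigr)+\frac{|Z_t^{(i)}|}{\sum_{z\in\Gamma_t}|z|}\;\longrightarrow\;1\qquad\text{in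 }\mathbf P\text{-probability.} \] -/

import Mathlib

open MeasureTheory ProbabilityTheory Filter Topology

noncomputable section

namespace BTM

/-! ### The Bouchaud trap model in a fixed trapping landscape

The Markov chain on `ℤ` started at `0` which jumps from `z` to each of `z + 1` and `z - 1` at rate
`1 / (2 σ z)`, built from its jump chain and holding times: at each visit to `z` it waits an
independent exponential time with mean `σ z`, then moves to a uniformly chosen neighbour of `z`. -/

/-- The uniform law on the two unit steps `+1` and `-1`. -/
def stepLaw : Measure ℤ :=
  (2⁻¹ : ENNReal) • Measure.dirac 1 + (2⁻¹ : ENNReal) • Measure.dirac (-1)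

/-- The law of one (unit step, standard exponential) pair, with independent entries. -/
def noiseLaw : Measure (ℤ × ℝ) := stepLaw.prod (expMeasure 1)

/-- The probability space which carries the chain: an i.i.d. sequence of independent pairs
(unit step, standard exponential variable). -/
def noise : Measure (ℕ → ℤ × ℝ) := Measure.infinitePi (fun _ : ℕ => noiseLaw)

instance isProbabilityMeasure_stepLaw : IsProbabilityMeasure stepLaw :=
  ⟨by simp [stepLaw, ENNReal.inv_two_add_inv_two]⟩

instance isProbabilityMeasure_noiseLaw : IsProbabilityMeasure noiseLaw := by
  have : IsProbabilityMeasure (expMeasure 1) := isProbabilityMeasure_expMeasure one_pos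
  unfold noiseLaw
  infer_instance

instance isProbabilityMeasure_noise : IsProbabilityMeasure noise := by
  unfold noise
  infer_instance

/-- The jump chain: simple symmetric random walk on `ℤ` started at `0`. -/
def jumpChain (w : ℕ → ℤ × ℝ) (n : ℕ) : ℤ := ∑ k ∈ Finset.range n, (w k).1

/-- The time of the `n`-th jump. The `k`-th holding time is exponential with mean
`σ (jumpChain w k)`, given the jump chain. -/
def jumpTime (σ : ℤ → ℝ) (w : ℕ → ℤ × ℝ) (n : ℕ) : ℝ :=
  ∑ k ∈ Finset.range n, σ (jumpChain w k) * (w k).2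

/-- The number of jumps made up to and including time `t`. (The set is almost surely non-empty when
all `σ z` are positive: the walk is recurrent, so the jump times tend to infinity.) -/
def jumpCount (σ : ℤ → ℝ) (t : ℝ) (w : ℕ → ℤ × ℝ) : ℕ :=
  sInf {n : ℕ | t < jumpTime σ w (n + 1)}

/-- The Bouchaud trap model `X_t` in the trapping landscape `σ`, started at `0`. -/
def X (σ : ℤ → ℝ) (t : ℝ) (w : ℕ → ℤ × ℝ) : ℤ := jumpChain w (jumpCount σ t w)

/-- The quenched probability `P_σ (X_t = z)`. -/
def quenchedProb (σ : ℤ → ℝ) (t : ℝ) (z : ℤ) : ℝ :=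
  noise.real {w | X σ t w = z}

/-! ### The localisation sites -/

/-- `L x = 1 / μ (Y > x)` for a real random variable `Y`. -/
def invTail {Ω : Type*} [MeasurableSpace Ω] (μ : Measure Ω) (Y : Ω → ℝ) (x : ℝ) : ℝ :=
  1 / μ.real {ω | x < Y ω}

/-- Slow variation at infinity. (For `L = invTail μ Y` this forces `μ (Y > x) > 0` for all `x`,
as otherwise the ratio is eventually `0 / 0 = 0`.) -/
def SlowlyVarying (L : ℝ → ℝ) : Prop :=
  ∀ v : ℝ, 0 < v → Tendsto (fun u : ℝ => L (u * v) / L u) atTop (𝓝 1)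

/-- The level `ℓ_t = min {s ≥ 0 : s L(s) ≥ t}`. -/
def level (L : ℝ → ℝ) (t : ℝ) : ℝ := sInf {s : ℝ | 0 ≤ s ∧ t ≤ s * L s}

/-- The positive site closest to the origin at which the trap exceeds the level `l`. -/
def posSite (σ : ℤ → ℝ) (l : ℝ) : ℤ := sInf {z : ℤ | 0 < z ∧ l < σ z}

/-- The negative site closest to the origin at which the trap exceeds the level `l`. -/
def negSite (σ : ℤ → ℝ) (l : ℝ) : ℤ := sSup {z : ℤ | z < 0 ∧ l < σ z}

/-- The localisation set, made of these two sites. -/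
def locSet (σ : ℤ → ℝ) (l : ℝ) : Finset ℤ := {posSite σ l, negSite σ l}

end BTM

end

noncomputable section

namespace BTM

open scoped ENNReal

/-! ### The holding-time operator -/

/-! Write `l` for the level at time `t` and `N = L(l)`, so that `t` is of order `l * N`. Traps
deeper than `l` have density `1 / N`. By slow variation such a trap is typically much deeper than
`l`, while the traps of depth at most `l` within distance of order `N` add up to far less than `l`.
The walk therefore crosses the shallow traps in time much shorter than `t`, and once it reaches a
deep trap it stays there for almost all of the time up to `t`. It is thus found at whichever of the
two nearest deep sites it hits first, and gambler's ruin gives the probability that this is not `b`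
as the distance to `b` over the sum of both distances.

The quenched half is `noise_real_X_ne_le`, for a window `a < b < c`. It bounds the probability to be
off `b` by three terms: the ruin probability of reaching `a` or `c` before `b`; a Markov bound for
the time needed to reach `b`; and the expected number of departures from `b` (at rate `1 / σ b`)
which lead out of the window or to an excursion still under way at time `t`. No stopping times
occur: the sum of these terms is a supersolution of the one-jump equation (`super_supersolution`),
and `measure_X_ne_le` turns any supersolution into a bound on the law of the chain. The occupation
times are controlled by the explicit Green function bound `green`.

Only upper bounds for being off a site are proved. Applied to both sites they suffice, because the
two ruin probabilities sum to one and being at one site excludes the other (`Typical.localisation`).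

The annealed half is a union bound (`measureReal_not_typical_le`). Its analytic input is
`tendsto_invTail_mul_integral_trunc`, which makes the shallow traps negligible, together with `L(M *
l) / L(l) → 1`, which makes the deep ones deeper than `M * l`. -/

lemma expMeasure_eq_withDensity :
    expMeasure 1 = (volume : Measure ℝ).withDensity (exponentialPDF 1) := rfl

instance : IsProbabilityMeasure (expMeasure 1) := isProbabilityMeasure_expMeasure one_pos

lemma measurable_exponentialPDF (r : ℝ) : Measurable (exponentialPDF r) :=
  (measurable_exponentialPDFReal r).ennreal_ofReal

lemma expMeasure_ae_nonneg : ∀ᵐ e ∂(expMeasure 1), 0 ≤ e := by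
  rw [ae_iff]
  simp only [not_le]
  change (expMeasure 1) (Set.Iio 0) = 0
  rw [expMeasure_eq_withDensity, withDensity_apply _ measurableSet_Iio]
  exact lintegral_exponentialPDF_of_nonpos le_rfl

/-- The probability that a holding time of mean `a` is longer than `s`. -/
def tail (a s : ℝ) : ℝ≥0∞ := expMeasure 1 {e | s < a * e}

/-- `hold a u s` is the expectation of `u (s - τ); τ ≤ s` for a holding time `τ` of mean `a`. -/
def hold (a : ℝ) (u : ℝ → ℝ≥0∞) (s : ℝ) : ℝ≥0∞ :=
  ∫⁻ e, (if a * e ≤ s then u (s - a * e) else 0) ∂(expMeasure 1)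

lemma measurable_hold_integrand (a : ℝ) {u : ℝ → ℝ≥0∞} (hu : Measurable u) :
    Measurable (fun p : ℝ × ℝ => if a * p.2 ≤ p.1 then u (p.1 - a * p.2) else 0) := by
  refine Measurable.ite (measurableSet_le (by fun_prop) (by fun_prop)) ?_ measurable_const
  exact hu.comp (by fun_prop)

lemma measurable_hold_integrand' (a s : ℝ) {u : ℝ → ℝ≥0∞} (hu : Measurable u) :
    Measurable (fun e : ℝ => if a * e ≤ s then u (s - a * e) else 0) :=
  (measurable_hold_integrand a hu).comp (by fun_prop : Measurable fun e : ℝ => (s, e))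

lemma measurable_hold (a : ℝ) {u : ℝ → ℝ≥0∞} (hu : Measurable u) : Measurable (hold a u) :=
  (measurable_hold_integrand a hu).lintegral_prod_right'

lemma measurable_tail (a : ℝ) : Measurable (tail a) := by
  have h : Measurable (fun s => (expMeasure 1) (Prod.mk s ⁻¹' {p : ℝ × ℝ | p.1 < a * p.2})) :=
    measurable_measure_prodMk_left (measurableSet_lt (by fun_prop) (by fun_prop))
  exact h

lemma hold_mono (a : ℝ) {u v : ℝ → ℝ≥0∞} {s : ℝ} (h : ∀ r, u r ≤ v r) :
    hold a u s ≤ hold a v s := by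
  refine lintegral_mono fun e => ?_
  dsimp only
  split_ifs
  · exact h _
  · exact le_rfl

lemma hold_add (a s : ℝ) {u : ℝ → ℝ≥0∞} (hu : Measurable u) (v : ℝ → ℝ≥0∞) :
    hold a (fun r => u r + v r) s = hold a u s + hold a v s := by
  unfold hold
  rw [← lintegral_add_left (measurable_hold_integrand' a s hu)]
  refine lintegral_congr fun e => ?_
  split_ifs <;> simp

lemma hold_const_mul (a s : ℝ) (c : ℝ≥0∞) {u : ℝ → ℝ≥0∞} (hu : Measurable u) :
    hold a (fun r => c * u r) s = c * hold a u s := by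
  unfold hold
  rw [← lintegral_const_mul _ (measurable_hold_integrand' a s hu)]
  refine lintegral_congr fun e => ?_
  split_ifs <;> simp

lemma measurableSet_tail (a s : ℝ) : MeasurableSet {e : ℝ | s < a * e} :=
  measurableSet_lt (by fun_prop) (by fun_prop)

lemma hold_one_add_tail (a s : ℝ) : hold a (fun _ => 1) s + tail a s = 1 := by
  have h : hold a (fun _ => 1) s = expMeasure 1 {e | s < a * e}ᶜ := by
    unfold hold
    rw [← lintegral_indicator_one (measurableSet_tail a s).compl]
    refine lintegral_congr fun e => ?_
    simp only [Set.indicator, Set.mem_compl_iff, Set.mem_ofPred_eq, not_lt, Pi.one_apply]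
  rw [h, tail, add_comm, measure_add_measure_compl (measurableSet_tail a s), measure_univ]

lemma hold_const_le (a s : ℝ) (c : ℝ≥0∞) : hold a (fun _ => c) s ≤ c := by
  have h := hold_const_mul a s c (u := fun _ => 1) measurable_const
  simp only [mul_one] at h
  rw [h]
  calc c * hold a (fun _ => 1) s ≤ c * 1 := by
        gcongr
        exact le_self_add.trans (hold_one_add_tail a s).le
    _ = c := mul_one c

lemma hold_le_of_monotone {a : ℝ} (ha : 0 ≤ a) {u : ℝ → ℝ≥0∞} (hu : Monotone u) (s : ℝ) :
    hold a u s ≤ u s := by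
  refine le_trans (lintegral_mono_ae (g := fun _ => u s) ?_) (by simp)
  filter_upwards [expMeasure_ae_nonneg] with e he
  split_ifs
  · exact hu (by nlinarith)
  · exact zero_le

lemma hold_of_neg {a : ℝ} (ha : 0 ≤ a) (u : ℝ → ℝ≥0∞) {s : ℝ} (hs : s < 0) : hold a u s = 0 := by
  refine (lintegral_congr_ae (g := fun _ => 0) ?_).trans (by simp)
  filter_upwards [expMeasure_ae_nonneg] with e he
  rw [if_neg]
  have := mul_nonneg ha he
  linarith

/-- `∫ hold a u ≤ ∫ u` over `[0, ∞)`. -/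
lemma lintegral_hold_le (a : ℝ) {u : ℝ → ℝ≥0∞} (hu : Measurable u) :
    ∫⁻ s, hold a u s ≤ ∫⁻ r in Set.Ici 0, u r := by
  unfold hold
  rw [lintegral_lintegral_swap (measurable_hold_integrand a hu).aemeasurable]
  calc _ = ∫⁻ _e : ℝ, (∫⁻ r in Set.Ici 0, u r) ∂(expMeasure 1) := by
        refine lintegral_congr fun e => ?_
        rw [← lintegral_indicator measurableSet_Ici]
        rw [← lintegral_sub_right_eq_self ((Set.Ici 0).indicator u) (a * e)]
        refine lintegral_congr fun s => ?_
        simp only [Set.indicator, Set.mem_Ici, sub_nonneg]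
    _ ≤ _ := by simp

lemma lintegral_comp_sub_mul {a : ℝ} (ha : 0 < a) (s : ℝ) (G : ℝ → ℝ≥0∞) (hG : Measurable G) :
    ∫⁻ e : ℝ, G (s - a * e) = ENNReal.ofReal a⁻¹ * ∫⁻ q, G q := by
  have h := Real.map_volume_mul_left ha.ne'
  have h2 : ∫⁻ e : ℝ, G (s - a * e) = ∫⁻ y, G (s - y) ∂(Measure.map (a * ·) volume) := by
    rw [lintegral_map (f := fun y => G (s - y)) (hG.comp (by fun_prop : Measurable fun y => s - y))
      (by fun_prop)]
  rw [h2, h, lintegral_smul_measure, abs_of_pos (inv_pos.2 ha), smul_eq_mul]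
  congr 1
  exact lintegral_sub_left_eq_self G s

lemma tail_of_nonneg {a s : ℝ} (ha : 0 < a) (hs : 0 ≤ s) :
    tail a s = ENNReal.ofReal (Real.exp (-(s / a))) := by
  have h : {e : ℝ | s < a * e} = (Set.Iic (s / a))ᶜ := by
    ext e
    simp only [Set.mem_ofPred_eq, Set.mem_compl_iff, Set.mem_Iic, not_le, div_lt_iff₀' ha]
  rw [tail, h, prob_compl_eq_one_sub measurableSet_Iic, ← ofReal_cdf,
    cdf_expMeasure_eq one_pos, if_pos (by positivity), ← ENNReal.ofReal_one,
    ← ENNReal.ofReal_sub _ (by rw [sub_nonneg, Real.exp_le_one_iff]; simp; positivity)]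
  congr 1
  simp

/-- The density of an exponential variable is its tail divided by its mean. This is the form in
which memorylessness enters. -/
lemma hold_eq {a : ℝ} (ha : 0 < a) {u : ℝ → ℝ≥0∞} (hu : Measurable u) (s : ℝ) :
    hold a u s = ENNReal.ofReal a⁻¹ * ∫⁻ q in Set.Icc 0 s, u q * tail a (s - q) := by
  have hG : Measurable fun q => u q * tail a (s - q) :=
    hu.mul ((measurable_tail a).comp (by fun_prop : Measurable fun q => s - q))
  rw [← lintegral_indicator measurableSet_Icc, ← lintegral_comp_sub_mul ha s _
    (hG.indicator measurableSet_Icc), hold,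
    expMeasure_eq_withDensity, lintegral_withDensity_eq_lintegral_mul _
    (measurable_exponentialPDF 1) (measurable_hold_integrand' a s hu)]
  refine lintegral_congr fun e => ?_
  simp only [Pi.mul_apply, Set.indicator, Set.mem_Icc, sub_nonneg, sub_le_self_iff, sub_sub_cancel]
  rcases lt_or_ge e 0 with he | he
  · rw [exponentialPDF_of_neg he, zero_mul, if_neg]
    intro h
    nlinarith [h.2]
  · have h0 : 0 ≤ a * e := by positivity
    rw [exponentialPDF_of_nonneg he, tail_of_nonneg ha h0, mul_div_cancel_left₀ _ ha.ne']
    simp only [h0, and_true, one_mul]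
    split_ifs
    · rw [mul_comm]
    · simp

lemma lintegral_tail_le {a : ℝ} (ha : 0 < a) : ∫⁻ s in Set.Ici 0, tail a s ≤ ENNReal.ofReal a := by
  calc ∫⁻ s in Set.Ici 0, tail a s
      = ∫⁻ s in Set.Ioi 0, ENNReal.ofReal (Real.exp (-(1 / a) * s)) := by
        rw [setLIntegral_congr Ioi_ae_eq_Ici.symm]
        refine setLIntegral_congr_fun measurableSet_Ioi fun s hs => ?_
        rw [tail_of_nonneg ha (le_of_lt hs)]
        congr 2
        ring
    _ = ENNReal.ofReal (∫ s in Set.Ioi 0, Real.exp (-(1 / a) * s)) := by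
        rw [ofReal_integral_eq_lintegral_ofReal]
        · exact (exp_neg_integrableOn_Ioi 0 (by positivity))
        · exact Eventually.of_forall fun s => (Real.exp_pos _).le
    _ ≤ _ := by
        rw [integral_exp_mul_Ioi (by simpa using ha)]
        simp

/-- The expected number of jumps during `[0, s]`, counted with weight `F`, from a site with mean
holding time `a` that is occupied at all times. -/
def cumul (a : ℝ) (F : ℝ → ℝ≥0∞) (s : ℝ) : ℝ≥0∞ := ENNReal.ofReal a⁻¹ * ∫⁻ q in Set.Icc 0 s, F q

lemma monotone_cumul (a : ℝ) (F : ℝ → ℝ≥0∞) : Monotone (cumul a F) := fun s t h => by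
  unfold cumul
  gcongr

lemma cumul_mono (a : ℝ) {F G : ℝ → ℝ≥0∞} (h : ∀ r, F r ≤ G r) (s : ℝ) :
    cumul a F s ≤ cumul a G s := by
  unfold cumul
  gcongr
  exact h _

/-- Renewal equation of a Poisson process, conditioning on its first point. By Fubini the second
term weights `F q` with the probability that `τ ≤ s - q`, by `hold_eq` the first weights it with the
complementary one. -/
lemma hold_add_hold_cumul {a : ℝ} (ha : 0 < a) {F : ℝ → ℝ≥0∞} (hF : Measurable F) (s : ℝ) :
    hold a F s + hold a (cumul a F) s = cumul a F s := by
  have hmeas : Measurable (fun p : ℝ × ℝ => if 0 ≤ p.2 ∧ p.2 ≤ s - a * p.1 then F p.2 else 0) := by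
    refine Measurable.ite (MeasurableSet.inter (s₁ := {p : ℝ × ℝ | 0 ≤ p.2})
      (s₂ := {p : ℝ × ℝ | p.2 ≤ s - a * p.1}) ?_ ?_) (by fun_prop) measurable_const
    · exact measurableSet_le (by fun_prop) (by fun_prop)
    · exact measurableSet_le (by fun_prop) (by fun_prop)
  have h1 : hold a (cumul a F) s = ENNReal.ofReal a⁻¹ * ∫⁻ e : ℝ,
      (∫⁻ q : ℝ, if 0 ≤ q ∧ q ≤ s - a * e then F q else 0) ∂(expMeasure 1) := by
    rw [← lintegral_const_mul _ hmeas.lintegral_prod_right']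
    refine lintegral_congr fun e => ?_
    have : (∫⁻ q : ℝ, if 0 ≤ q ∧ q ≤ s - a * e then F q else 0) =
        ∫⁻ q in Set.Icc 0 (s - a * e), F q := by
      rw [← lintegral_indicator measurableSet_Icc]
      simp only [Set.indicator, Set.mem_Icc]
    rw [this]
    split_ifs with h
    · rfl
    · rw [Set.Icc_eq_empty (by linarith)]
      simp
  have h2 : (∫⁻ e : ℝ, (∫⁻ q : ℝ, if 0 ≤ q ∧ q ≤ s - a * e then F q else 0) ∂(expMeasure 1)) =
      ∫⁻ q in Set.Icc 0 s, F q * hold a (fun _ => 1) (s - q) := by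
    rw [lintegral_lintegral_swap hmeas.aemeasurable, ← lintegral_indicator measurableSet_Icc]
    refine lintegral_congr fun q => ?_
    simp only [Set.indicator, Set.mem_Icc]
    have h3 : (∫⁻ e : ℝ, (if 0 ≤ q ∧ q ≤ s - a * e then F q else 0) ∂(expMeasure 1)) =
        if 0 ≤ q then F q * hold a (fun _ => 1) (s - q) else 0 := by
      split_ifs with hq
      · rw [hold, ← lintegral_const_mul _ (measurable_hold_integrand' a (s - q) measurable_const)]
        refine lintegral_congr fun e => ?_
        have : q ≤ s - a * e ↔ a * e ≤ s - q := by constructor <;> intro <;> linarith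
        simp only [hq, true_and, this, mul_ite, mul_one, mul_zero]
      · simp [hq]
    rw [h3]
    by_cases hqs : q ≤ s
    · simp [hqs]
    · rw [hold_of_neg ha.le _ (by linarith)]
      simp [hqs]
  have hG : Measurable fun q => F q * tail a (s - q) :=
    hF.mul ((measurable_tail a).comp (by fun_prop : Measurable fun q => s - q))
  rw [h1, h2, hold_eq ha hF, ← mul_add, ← lintegral_add_left hG, cumul]
  congr 1
  refine lintegral_congr fun q => ?_
  rw [← mul_add, add_comm, hold_one_add_tail, mul_one]

/-! ### Supersolutions bound the law of the chain -/

lemma measurable_jumpChain (n : ℕ) : Measurable fun w : ℕ → ℤ × ℝ => jumpChain w n := by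
  unfold jumpChain
  fun_prop

lemma measurable_jumpTime (σ : ℤ → ℝ) (n : ℕ) :
    Measurable fun w : ℕ → ℤ × ℝ => jumpTime σ w n := by
  unfold jumpTime
  refine Finset.measurable_sum _ fun k _ => Measurable.mul ?_ (by fun_prop)
  exact (measurable_of_countable σ).comp (measurable_jumpChain k)

lemma jumpTime_succ (σ : ℤ → ℝ) (w : ℕ → ℤ × ℝ) (n : ℕ) :
    jumpTime σ w (n + 1) = jumpTime σ w n + σ (jumpChain w n) * (w n).2 :=
  Finset.sum_range_succ _ _

lemma jumpChain_succ (w : ℕ → ℤ × ℝ) (n : ℕ) :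
    jumpChain w (n + 1) = jumpChain w n + (w n).1 :=
  Finset.sum_range_succ _ _

lemma lintegral_noiseLaw {F : ℤ × ℝ → ℝ≥0∞} (hF : Measurable F) :
    ∫⁻ y, F y ∂noiseLaw = 2⁻¹ * (∫⁻ e, F (1, e) ∂(expMeasure 1) + ∫⁻ e, F (-1, e) ∂(expMeasure 1)) := by
  rw [noiseLaw, lintegral_prod _ hF.aemeasurable, stepLaw, lintegral_add_measure,
    lintegral_smul_measure, lintegral_smul_measure, lintegral_dirac, lintegral_dirac, smul_eq_mul,
    smul_eq_mul, mul_add]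

/-- The `k`-th entry of the noise is independent of the chain up to its `k`-th jump. -/
lemma lintegral_noise_next (σ : ℤ → ℝ) (k : ℕ) {G : (ℝ × ℤ) × (ℤ × ℝ) → ℝ≥0∞}
    (hG : Measurable G) :
    ∫⁻ w, G ((jumpTime σ w k, jumpChain w k), w k) ∂noise =
      ∫⁻ w, ∫⁻ y, G ((jumpTime σ w k, jumpChain w k), y) ∂noiseLaw ∂noise := by
  have hind : iIndepFun (fun (i : ℕ) (w : ℕ → ℤ × ℝ) => w i) noise :=
    iIndepFun_infinitePi (P := fun _ : ℕ => noiseLaw) (X := fun _ y => y) fun _ => measurable_id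
  have h1 := hind.indepFun_finset (Finset.range k) {k} (by simp) (fun i => measurable_pi_apply i)
  -- Padding with zeros makes the chain up to jump `k` a function of the first `k` entries alone;
  -- the padded entries are never read.
  let past : ((i : Finset.range k) → ℤ × ℝ) → ℕ → ℤ × ℝ := fun v i =>
    if h : i ∈ Finset.range k then v ⟨i, h⟩ else 0
  have hpast : Measurable past := by
    refine measurable_pi_lambda _ fun i => ?_
    by_cases h : i ∈ Finset.range k
    · simp only [past, h, dite_true]
      exact measurable_pi_apply _
    · simp only [past, h, dite_false]
      exact measurable_const
  have hlast : Measurable fun v : ({k} : Finset ℕ) → ℤ × ℝ => v ⟨k, Finset.mem_singleton_self k⟩ :=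
    measurable_pi_apply _
  have h2 := h1.comp (φ := fun v => (jumpTime σ (past v) k, jumpChain (past v) k))
    (ψ := fun v : ({k} : Finset ℕ) → ℤ × ℝ =>
      v ⟨k, Finset.mem_singleton_self k⟩)
    (((measurable_jumpTime σ k).comp hpast).prodMk ((measurable_jumpChain k).comp hpast))
    hlast
  have hchain : ∀ (w : ℕ → ℤ × ℝ) (i : ℕ), i ≤ k →
      jumpChain (past fun j => w j) i = jumpChain w i := by
    intro w i hi
    refine Finset.sum_congr rfl fun j hj => ?_
    have : j < k := (Finset.mem_range.1 hj).trans_le hi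
    simp [past, this]
  have htime : ∀ w : ℕ → ℤ × ℝ, jumpTime σ (past fun j => w j) k = jumpTime σ w k := by
    intro w
    refine Finset.sum_congr rfl fun j hj => ?_
    rw [hchain w j (Finset.mem_range.1 hj).le]
    simp [past, Finset.mem_range.1 hj]
  have h3 : IndepFun (fun w : ℕ → ℤ × ℝ => (jumpTime σ w k, jumpChain w k)) (fun w => w k) noise := by
    refine h2.congr (Eventually.of_forall fun w => ?_) (Eventually.of_forall fun w => rfl)
    simp only [Function.comp]
    rw [hchain w k le_rfl, htime w]
  have hT : Measurable fun w : ℕ → ℤ × ℝ => (jumpTime σ w k, jumpChain w k) :=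
    (measurable_jumpTime σ k).prodMk (measurable_jumpChain k)
  have h4 := (indepFun_iff_map_prod_eq_prod_map_map hT.aemeasurable
    (measurable_pi_apply k).aemeasurable).1 h3
  have h5 : Measure.map (fun w : ℕ → ℤ × ℝ => w k) noise = noiseLaw :=
    Measure.infinitePi_map_eval (fun _ : ℕ => noiseLaw) k
  rw [← lintegral_map hG (hT.prodMk (measurable_pi_apply k)), h4, h5,
    lintegral_prod _ hG.aemeasurable, lintegral_map hG.lintegral_prod_right' hT]

/-- The jump operator of the chain: `step σ f s x` is the expectation of `f (s - τ) y; τ ≤ s`, where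
`τ` is a holding time at `x` and `y` a uniform neighbour of `x`. -/
def step (σ : ℤ → ℝ) (f : ℝ → ℤ → ℝ≥0∞) (s : ℝ) (x : ℤ) : ℝ≥0∞ :=
  2⁻¹ * (hold (σ x) (fun r => f r (x + 1)) s + hold (σ x) (fun r => f r (x - 1)) s)

/-- `X` is either off `b` between two consecutive jumps, or has made `n` jumps by time `t`. -/
lemma X_ne_imp (σ : ℤ → ℝ) {t : ℝ} (ht : 0 ≤ t) (b : ℤ) (n : ℕ) (w : ℕ → ℤ × ℝ)
    (h : X σ t w ≠ b) :
    (∃ k < n, jumpTime σ w k ≤ t ∧ t < jumpTime σ w (k + 1) ∧ jumpChain w k ≠ b) ∨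
      jumpTime σ w n ≤ t := by
  by_contra! hcon
  obtain ⟨h1, h2⟩ := hcon
  have h0 : jumpTime σ w 0 ≤ t := by simpa [jumpTime] using ht
  obtain ⟨m, rfl⟩ : ∃ m, n = m + 1 := by
    refine Nat.exists_eq_succ_of_ne_zero ?_
    rintro rfl
    linarith
  have hne : {n : ℕ | t < jumpTime σ w (n + 1)}.Nonempty := ⟨m, h2⟩
  have hmem : t < jumpTime σ w (jumpCount σ t w + 1) := Nat.sInf_mem hne
  have hle : jumpCount σ t w ≤ m := Nat.sInf_le h2
  refine h (h1 _ (by omega) ?_ hmem)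
  rcases Nat.eq_zero_or_pos (jumpCount σ t w) with hz | hz
  · rw [hz]
    exact h0
  · have : jumpCount σ t w - 1 ∉ {n : ℕ | t < jumpTime σ w (n + 1)} :=
      Nat.notMem_of_lt_sInf (show jumpCount σ t w - 1 < jumpCount σ t w by omega)
    simpa [Nat.sub_add_cancel hz] using this

/-- Comparison principle by induction on jumps, where `j` counts the jumps still allowed. The last
term `hinit` pays for having made all `n` jumps by time `t`, so neither recurrence nor non-explosion
is needed here. -/
theorem measure_X_ne_le {σ : ℤ → ℝ} (hσ : ∀ z, 0 < σ z) {t : ℝ} (ht : 0 ≤ t) (b : ℤ)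
    (ψ : ℕ → ℝ → ℤ → ℝ≥0∞) (hψ : ∀ j x, Measurable fun s => ψ j s x)
    (hinit : ∀ s x, 0 ≤ s → 1 ≤ ψ 0 s x)
    (hsuper : ∀ j s x, 0 ≤ s →
      (if x ≠ b then tail (σ x) s else 0) + step σ (ψ j) s x ≤ ψ (j + 1) s x) (n : ℕ) :
    noise {w | X σ t w ≠ b} ≤ ψ n t 0 := by
  let lost : ℕ → Set (ℕ → ℤ × ℝ) := fun k =>
    {w | jumpTime σ w k ≤ t ∧ t < jumpTime σ w (k + 1) ∧ jumpChain w k ≠ b}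
  let V : ℕ → ℕ → ℝ≥0∞ := fun k j => ∫⁻ w,
    (if jumpTime σ w k ≤ t then ψ j (t - jumpTime σ w k) (jumpChain w k) else 0) ∂noise
  have hlost : ∀ k, MeasurableSet (lost k) := fun k => by
    refine MeasurableSet.inter (s₁ := {w | jumpTime σ w k ≤ t})
      (s₂ := {w | t < jumpTime σ w (k + 1) ∧ jumpChain w k ≠ b})
      (measurableSet_le (measurable_jumpTime σ k) measurable_const)
      (MeasurableSet.inter (s₁ := {w | t < jumpTime σ w (k + 1)})
      (s₂ := {w | jumpChain w k ≠ b})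
      (measurableSet_lt measurable_const (measurable_jumpTime σ (k + 1)))
      ?_)
    exact (measurable_jumpChain k) (MeasurableSet.of_discrete (s := {b}ᶜ))
  have hψ2 : ∀ j, Measurable fun p : ℝ × ℤ => ψ j p.1 p.2 := fun j =>
    measurable_from_prod_countable_left fun x => hψ j x
  have hσm : Measurable σ := measurable_of_countable σ
  -- Markov property at the `k`-th jump: integrating out the `k`-th noise pair turns the left side
  -- into the left side of `hsuper`.
  have hstep : ∀ k j, noise (lost k) + V (k + 1) j ≤ V k (j + 1) := by
    intro k j
    let G1 : (ℝ × ℤ) × (ℤ × ℝ) → ℝ≥0∞ := fun p =>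
      if p.1.1 ≤ t ∧ t < p.1.1 + σ p.1.2 * p.2.2 ∧ p.1.2 ≠ b then 1 else 0
    let G2 : (ℝ × ℤ) × (ℤ × ℝ) → ℝ≥0∞ := fun p =>
      if p.1.1 + σ p.1.2 * p.2.2 ≤ t then
        ψ j (t - (p.1.1 + σ p.1.2 * p.2.2)) (p.1.2 + p.2.1) else 0
    have hlin : Measurable fun p : (ℝ × ℤ) × (ℤ × ℝ) => p.1.1 + σ p.1.2 * p.2.2 := by fun_prop
    have hG1 : Measurable G1 := by
      refine Measurable.ite (MeasurableSet.inter (s₁ := {p : (ℝ × ℤ) × (ℤ × ℝ) | p.1.1 ≤ t})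
        (s₂ := {p : (ℝ × ℤ) × (ℤ × ℝ) | t < p.1.1 + σ p.1.2 * p.2.2 ∧ p.1.2 ≠ b})
        (measurableSet_le (by fun_prop) measurable_const)
        (MeasurableSet.inter (s₁ := {p : (ℝ × ℤ) × (ℤ × ℝ) | t < p.1.1 + σ p.1.2 * p.2.2})
          (s₂ := {p : (ℝ × ℤ) × (ℤ × ℝ) | p.1.2 ≠ b})
          (measurableSet_lt measurable_const hlin) ?_)) measurable_const measurable_const
      exact (measurable_snd.comp measurable_fst) (MeasurableSet.of_discrete (s := {b}ᶜ))
    have hG2 : Measurable G2 := by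
      refine Measurable.ite (measurableSet_le hlin measurable_const) ?_ measurable_const
      exact (hψ2 j).comp ((measurable_const.sub hlin).prodMk (by fun_prop))
    have e1 : noise (lost k) = ∫⁻ w, G1 ((jumpTime σ w k, jumpChain w k), w k) ∂noise := by
      rw [← lintegral_indicator_one (hlost k)]
      refine lintegral_congr fun w => ?_
      simp only [G1, lost, Set.indicator, Set.mem_ofPred_eq, jumpTime_succ, Pi.one_apply]
    have e2 : V (k + 1) j = ∫⁻ w, G2 ((jumpTime σ w k, jumpChain w k), w k) ∂noise := by
      refine lintegral_congr fun w => ?_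
      simp only [G2, jumpTime_succ, jumpChain_succ]
    have hk : Measurable fun w : ℕ → ℤ × ℝ => ((jumpTime σ w k, jumpChain w k), w k) :=
      ((measurable_jumpTime σ k).prodMk (measurable_jumpChain k)).prodMk (measurable_pi_apply k)
    have hsec : ∀ (τ : ℝ) (x : ℤ), Measurable fun y : ℤ × ℝ => ((τ, x), y) := fun τ x => by fun_prop
    have hG1s : ∀ (τ : ℝ) (x : ℤ), Measurable fun y : ℤ × ℝ => G1 ((τ, x), y) := fun τ x =>
      hG1.comp (hsec τ x)
    have hG2s : ∀ (τ : ℝ) (x : ℤ), Measurable fun y : ℤ × ℝ => G2 ((τ, x), y) := fun τ x =>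
      hG2.comp (hsec τ x)
    have hG1k : Measurable fun w : ℕ → ℤ × ℝ => G1 ((jumpTime σ w k, jumpChain w k), w k) :=
      hG1.comp hk
    have i1 : ∀ (τ : ℝ) (x : ℤ), ∫⁻ y, G1 ((τ, x), y) ∂noiseLaw =
        if τ ≤ t then (if x ≠ b then tail (σ x) (t - τ) else 0) else 0 := by
      intro τ x
      rw [lintegral_noiseLaw (hG1s τ x)]
      have : ∀ d : ℤ, ∫⁻ e, G1 ((τ, x), (d, e)) ∂(expMeasure 1) =
          if τ ≤ t then (if x ≠ b then tail (σ x) (t - τ) else 0) else 0 := by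
        intro d
        by_cases h1 : τ ≤ t
        · by_cases h2 : x ≠ b
          · simp only [G1, h1, h2, ne_eq, not_false_eq_true, and_true, true_and, if_true]
            rw [tail, ← lintegral_indicator_one (measurableSet_tail _ _)]
            refine lintegral_congr fun e => ?_
            simp only [Set.indicator, Set.mem_ofPred_eq, Pi.one_apply, sub_lt_iff_lt_add']
          · simp [G1, h2]
        · simp [G1, h1]
      rw [this, ← two_mul, ← mul_assoc, ENNReal.inv_mul_cancel (by simp) (by simp), one_mul]
    have i2 : ∀ (τ : ℝ) (x : ℤ), ∫⁻ y, G2 ((τ, x), y) ∂noiseLaw = step σ (ψ j) (t - τ) x := by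
      intro τ x
      rw [lintegral_noiseLaw (hG2s τ x)]
      have : ∀ d : ℤ, ∫⁻ e, G2 ((τ, x), (d, e)) ∂(expMeasure 1) =
          hold (σ x) (fun r => ψ j r (x + d)) (t - τ) := by
        intro d
        refine lintegral_congr fun e => ?_
        simp only [G2, le_sub_iff_add_le', sub_sub]
      rw [this, this]
      rfl
    rw [e1, e2, ← lintegral_add_left hG1k]
    refine (lintegral_noise_next σ k (hG1.add hG2)).trans_le ?_
    refine lintegral_mono fun w => ?_
    have : ∀ y, (G1 + G2) ((jumpTime σ w k, jumpChain w k), y) =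
      G1 ((jumpTime σ w k, jumpChain w k), y) + G2 ((jumpTime σ w k, jumpChain w k), y) :=
      fun y => rfl
    simp only [this]
    rw [lintegral_add_left (hG1s _ _), i1, i2]
    by_cases h : jumpTime σ w k ≤ t
    · simp only [h, if_true]
      exact hsuper j _ _ (by linarith)
    · simp only [h, if_false, zero_add, step]
      rw [hold_of_neg (hσ _).le _ (by linarith), hold_of_neg (hσ _).le _ (by linarith)]
      simp
  have hsum : ∀ k j, ∑ i ∈ Finset.range k, noise (lost i) + V k j ≤ V 0 (k + j) := by
    intro k
    induction k with
    | zero => intro j; simp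
    | succ k ih =>
      intro j
      rw [Finset.sum_range_succ, add_assoc]
      refine le_trans (add_le_add le_rfl (hstep k j)) ((ih (j + 1)).trans_eq ?_)
      congr 1
      omega
  have hV0 : V 0 n = ψ n t 0 := by
    simp [V, jumpTime, jumpChain, ht]
  have hVn : noise {w | jumpTime σ w n ≤ t} ≤ V n 0 := by
    rw [← lintegral_indicator_one (measurableSet_le (measurable_jumpTime σ n) measurable_const)]
    refine lintegral_mono fun w => ?_
    simp only [Set.indicator, Set.mem_ofPred_eq, Pi.one_apply]
    split_ifs with h
    · exact hinit _ _ (by linarith)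
    · exact le_rfl
  calc noise {w | X σ t w ≠ b}
      ≤ noise ((⋃ k ∈ Finset.range n, lost k) ∪ {w | jumpTime σ w n ≤ t}) := by
        refine measure_mono fun w hw => ?_
        rcases X_ne_imp σ ht b n w hw with ⟨k, hk, h⟩ | h
        · exact Or.inl (Set.mem_biUnion (by simpa using hk) h)
        · exact Or.inr h
    _ ≤ ∑ k ∈ Finset.range n, noise (lost k) + V n 0 :=
        (measure_union_le _ _).trans (add_le_add (measure_biUnion_finset_le _ _) hVn)
    _ ≤ ψ n t 0 := by simpa [hV0] using hsum n 0

/-! ### The jump operator -/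

lemma measurable_step (σ : ℤ → ℝ) {f : ℝ → ℤ → ℝ≥0∞} (hf : ∀ x, Measurable fun s => f s x) (x : ℤ) :
    Measurable fun s => step σ f s x :=
  ((measurable_hold _ (hf _)).add (measurable_hold _ (hf _))).const_mul _

lemma step_mono (σ : ℤ → ℝ) {f g : ℝ → ℤ → ℝ≥0∞} (h : ∀ s x, f s x ≤ g s x) (s : ℝ) (x : ℤ) :
    step σ f s x ≤ step σ g s x := by
  unfold step
  gcongr <;> exact hold_mono _ fun r => h _ _

lemma step_add (σ : ℤ → ℝ) {f : ℝ → ℤ → ℝ≥0∞} (hf : ∀ x, Measurable fun s => f s x)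
    (g : ℝ → ℤ → ℝ≥0∞) (s : ℝ) (x : ℤ) :
    step σ (fun s x => f s x + g s x) s x = step σ f s x + step σ g s x := by
  unfold step
  rw [hold_add _ _ (hf _), hold_add _ _ (hf _)]
  ring

lemma inv_two_mul_add_self (y : ℝ≥0∞) : 2⁻¹ * (y + y) = y := by
  rw [← two_mul, ← mul_assoc, ENNReal.inv_mul_cancel (by simp) (by simp), one_mul]

lemma inv_two_mul_ofReal_add {p q : ℝ} (hp : 0 ≤ p) (hq : 0 ≤ q) :
    2⁻¹ * (ENNReal.ofReal p + ENNReal.ofReal q) = ENNReal.ofReal ((p + q) / 2) := by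
  rw [← ENNReal.ofReal_add hp hq, div_eq_inv_mul, ENNReal.ofReal_mul (by norm_num),
    ENNReal.ofReal_inv_of_pos (by norm_num)]
  simp

lemma step_time_only (σ : ℤ → ℝ) (w : ℝ → ℝ≥0∞) (s : ℝ) (x : ℤ) :
    step σ (fun r _ => w r) s x = hold (σ x) w s :=
  inv_two_mul_add_self _

lemma step_space_only_le (σ : ℤ → ℝ) (c : ℤ → ℝ≥0∞) (s : ℝ) (x : ℤ) :
    step σ (fun _ y => c y) s x ≤ 2⁻¹ * (c (x + 1) + c (x - 1)) := by
  unfold step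
  gcongr <;> exact hold_const_le _ _ _

lemma tail_add_step_one (σ : ℤ → ℝ) (s : ℝ) (x : ℤ) :
    tail (σ x) s + step σ (fun _ _ => 1) s x = 1 := by
  rw [step_time_only, add_comm, hold_one_add_tail]

lemma tail_add_hold (a s : ℝ) (u : ℝ → ℝ≥0∞) :
    tail a s + hold a u s = ∫⁻ e, (if a * e ≤ s then u (s - a * e) else 1) ∂(expMeasure 1) := by
  rw [tail, ← lintegral_indicator_one (measurableSet_tail a s), hold,
    ← lintegral_add_left (measurable_one.indicator (measurableSet_tail a s))]
  refine lintegral_congr fun e => ?_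
  by_cases h : a * e ≤ s
  · simp [Set.indicator, h, not_lt.2 h]
  · simp [Set.indicator, h, not_le.1 h]

lemma antitone_tail_add_hold (a : ℝ) {u : ℝ → ℝ≥0∞} (hu : Antitone u) (hu1 : ∀ r, u r ≤ 1) :
    Antitone fun s => tail a s + hold a u s := by
  intro s s' hs
  simp only [tail_add_hold]
  refine lintegral_mono fun e => ?_
  dsimp only
  split_ifs with h1 h2 h2
  · exact hu (by linarith)
  · exact hu1 _
  · exact absurd (h2.trans hs) h1
  · exact le_rfl

/-! ### Survival in a punctured interval -/

/-- The probability that the chain started at `x` makes fewer than `j` jumps and stays in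
`(a, c) \ {b}` during `[0, s]`. -/
def survive (σ : ℤ → ℝ) (a b c : ℤ) : ℕ → ℝ → ℤ → ℝ≥0∞
  | 0 => fun _ _ => 0
  | j + 1 => fun s x =>
    if a < x ∧ x < c ∧ x ≠ b then tail (σ x) s + step σ (survive σ a b c j) s x else 0

lemma measurable_survive (σ : ℤ → ℝ) (a b c : ℤ) (j : ℕ) (x : ℤ) :
    Measurable fun s => survive σ a b c j s x := by
  induction j generalizing x with
  | zero => exact measurable_const
  | succ j ih =>
    simp only [survive]
    split_ifs
    · exact (measurable_tail _).add (measurable_step σ ih x)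
    · exact measurable_const

lemma survive_le_succ (σ : ℤ → ℝ) (a b c : ℤ) (j : ℕ) (s : ℝ) (x : ℤ) :
    survive σ a b c j s x ≤ survive σ a b c (j + 1) s x := by
  induction j generalizing s x with
  | zero => exact zero_le
  | succ j ih =>
    rw [survive, survive]
    dsimp only
    split_ifs
    · exact add_le_add le_rfl (step_mono σ ih s x)
    · exact le_rfl

lemma survive_le_one (σ : ℤ → ℝ) (a b c : ℤ) (j : ℕ) (s : ℝ) (x : ℤ) :
    survive σ a b c j s x ≤ 1 := by
  induction j generalizing s x with
  | zero => exact zero_le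
  | succ j ih =>
    rw [survive]
    dsimp only
    split_ifs
    · exact (add_le_add le_rfl (step_mono σ ih s x)).trans (tail_add_step_one σ s x).le
    · exact zero_le

/-- The value is at most `1`, which is what a holding time outlasting `s` contributes, so shortening
`s` can only raise the integrand. The tail is split in halves to pair one with each neighbour. -/
lemma antitone_survive (σ : ℤ → ℝ) (a b c : ℤ) (j : ℕ) (x : ℤ) :
    Antitone fun s => survive σ a b c j s x := by
  induction j generalizing x with
  | zero => exact antitone_const
  | succ j ih =>
    simp only [survive]
    split_ifs
    · have h : ∀ s, tail (σ x) s + step σ (survive σ a b c j) s x =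
          2⁻¹ * ((tail (σ x) s + hold (σ x) (fun r => survive σ a b c j r (x + 1)) s) +
            (tail (σ x) s + hold (σ x) (fun r => survive σ a b c j r (x - 1)) s)) := by
        intro s
        conv_lhs => rw [← inv_two_mul_add_self (tail (σ x) s), step]
        ring
      intro s s' hs
      simp only [h]
      gcongr 2⁻¹ * (?_ + ?_)
      · exact antitone_tail_add_hold _ (ih _) (fun r => survive_le_one ..) hs
      · exact antitone_tail_add_hold _ (ih _) (fun r => survive_le_one ..) hs
    · exact antitone_const

/-- A bound for the expected time spent in `(a, c) \ {b}`. -/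
def green (σ : ℤ → ℝ) (a b c x : ℤ) : ℝ :=
  ∑ z ∈ (Finset.Ioo a c).erase b, σ z * ((2 * min |x - b| |z - b| : ℤ) : ℝ)

lemma green_nonneg {σ : ℤ → ℝ} (hσ : ∀ z, 0 < σ z) (a b c x : ℤ) : 0 ≤ green σ a b c x := by
  refine Finset.sum_nonneg fun z _ => mul_nonneg (hσ z).le ?_
  have : 0 ≤ 2 * min |x - b| |z - b| := by positivity
  exact_mod_cast this

lemma green_le {σ : ℤ → ℝ} (hσ : ∀ z, 0 < σ z) (a b c x : ℤ) :
    green σ a b c x ≤ 2 * |(x : ℝ) - b| * ∑ z ∈ (Finset.Ioo a c).erase b, σ z := by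
  rw [green, Finset.mul_sum]
  refine Finset.sum_le_sum fun z _ => ?_
  have : (2 * min |x - b| |z - b| : ℤ) ≤ 2 * |x - b| := by
    have := min_le_left |x - b| |z - b|
    linarith
  have h2 : ((2 * min |x - b| |z - b| : ℤ) : ℝ) ≤ 2 * |(x : ℝ) - b| := by exact_mod_cast this
  nlinarith [hσ z]

/-- For `x`, `z` on the same side of `b`, `2 * min |x - b| |z - b|` is the Green function of the
walk killed at `b`. It is concave in `x` on each side and its slope drops by `2` at `z`. Ignoring
the killing at `a` and `c`, and being positive across `b`, only makes it larger. -/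
lemma green_superharmonic {σ : ℤ → ℝ} (hσ : ∀ z, 0 < σ z) {a b c x : ℤ} (h : a < x ∧ x < c ∧ x ≠ b) :
    σ x + (green σ a b c (x + 1) + green σ a b c (x - 1)) / 2 ≤ green σ a b c x := by
  have hx : x ∈ (Finset.Ioo a c).erase b := by simp [h]
  have key : ∀ z, (if z = x then 1 else 0) + (2 * min |x + 1 - b| |z - b| +
      2 * min |x - 1 - b| |z - b|) / 2 ≤ 2 * min |x - b| |z - b| := by
    intro z
    have := h.2.2
    simp only [abs_eq_max_neg]
    split_ifs <;> omega
  have key2 : ∀ z, (if z = x then (1 : ℝ) else 0) + (((2 * min |x + 1 - b| |z - b| : ℤ) : ℝ) +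
      ((2 * min |x - 1 - b| |z - b| : ℤ) : ℝ)) / 2 ≤ ((2 * min |x - b| |z - b| : ℤ) : ℝ) := by
    intro z
    have h1 := key z
    -- The integer division in `key` is exact because the numerator is even; clearing it first lets
    -- the inequality be cast.
    rw [← mul_add, Int.mul_ediv_cancel_left _ (by norm_num)] at h1
    have h2 : ((((if z = x then 1 else 0) + (min |x + 1 - b| |z - b| + min |x - 1 - b| |z - b|)
      : ℤ)) : ℝ) ≤ ((2 * min |x - b| |z - b| : ℤ) : ℝ) := by exact_mod_cast h1
    refine le_trans (le_of_eq ?_) h2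
    push_cast
    ring
  have h0 : σ x = ∑ z ∈ (Finset.Ioo a c).erase b, σ z * (if z = x then (1 : ℝ) else 0) := by
    simp [Finset.sum_ite_eq', hx]
  rw [h0]
  unfold green
  rw [← Finset.sum_add_distrib, Finset.sum_div, ← Finset.sum_add_distrib]
  refine Finset.sum_le_sum fun z _ => ?_
  have := mul_le_mul_of_nonneg_left (key2 z) (hσ z).le
  linarith

/-- The integral of a survival probability is an expected lifetime: one mean holding time plus the
average over the neighbours, which `green_superharmonic` absorbs. -/
lemma lintegral_survive_le {σ : ℤ → ℝ} (hσ : ∀ z, 0 < σ z) (a b c : ℤ) (j : ℕ) (x : ℤ) :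
    ∫⁻ s in Set.Ici 0, survive σ a b c j s x ≤ ENNReal.ofReal (green σ a b c x) := by
  induction j generalizing x with
  | zero => simp [survive]
  | succ j ih =>
    simp only [survive]
    split_ifs with h
    · rw [lintegral_add_left (measurable_tail _)]
      have hm := fun y => measurable_hold (σ x) (measurable_survive σ a b c j y)
      have hI : ∀ y, ∫⁻ s in Set.Ici 0, hold (σ x) (fun r => survive σ a b c j r y) s ≤
          ENNReal.ofReal (green σ a b c y) := fun y =>
        (setLIntegral_le_lintegral _ _).trans
          ((lintegral_hold_le (σ x) (measurable_survive σ a b c j y)).trans (ih y))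
      calc _ ≤ ENNReal.ofReal (σ x) + 2⁻¹ * (ENNReal.ofReal (green σ a b c (x + 1)) +
            ENNReal.ofReal (green σ a b c (x - 1))) := by
            refine add_le_add (lintegral_tail_le (hσ x)) ?_
            unfold step
            rw [lintegral_const_mul _ ((hm _).fun_add (hm _)), lintegral_add_left (hm _)]
            gcongr <;> exact hI _
        _ ≤ _ := by
            rw [inv_two_mul_ofReal_add (green_nonneg hσ ..) (green_nonneg hσ ..),
              ← ENNReal.ofReal_add (hσ x).le
                (by have := green_nonneg hσ a b c (x + 1)
                    have := green_nonneg hσ a b c (x - 1)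
                    positivity)]
            exact ENNReal.ofReal_le_ofReal (green_superharmonic hσ h)
    · simp

lemma lintegral_Icc_survive_le {σ : ℤ → ℝ} (hσ : ∀ z, 0 < σ z) (a b c : ℤ) (j : ℕ) (t : ℝ) (x : ℤ) :
    ∫⁻ s in Set.Icc 0 t, survive σ a b c j s x ≤ ENNReal.ofReal (green σ a b c x) :=
  (lintegral_mono_set Set.Icc_subset_Ici_self).trans (lintegral_survive_le hσ a b c j x)

/-- Markov's inequality for the lifetime, by monotonicity in time. -/
lemma survive_le {σ : ℤ → ℝ} (hσ : ∀ z, 0 < σ z) (a b c : ℤ) (j : ℕ) {t : ℝ} (ht : 0 < t) (x : ℤ) :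
    survive σ a b c j t x ≤ ENNReal.ofReal (green σ a b c x / t) := by
  rw [ENNReal.ofReal_div_of_pos ht, ENNReal.le_div_iff_mul_le (by simp [ht]) (by simp)]
  refine le_trans ?_ (lintegral_Icc_survive_le hσ a b c j t x)
  calc survive σ a b c j t x * ENNReal.ofReal t
      = ∫⁻ _s in Set.Icc 0 t, survive σ a b c j t x := by simp
    _ ≤ _ := setLIntegral_mono' measurableSet_Icc fun s hs => antitone_survive σ a b c j x hs.2

/-! ### The quenched bound -/

/-- The piecewise linear function which vanishes at `b` and is `1` at `a` and `c`. -/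
def exitProb (a b c x : ℤ) : ℝ :=
  if x ≤ b then ((b : ℝ) - x) / (b - a) else ((x : ℝ) - b) / (c - b)

lemma exitProb_nonneg {a b c : ℤ} (hab : a < b) (hbc : b < c) (x : ℤ) : 0 ≤ exitProb a b c x := by
  have h1 : (a : ℝ) < b := by exact_mod_cast hab
  have h2 : (b : ℝ) < c := by exact_mod_cast hbc
  unfold exitProb
  split_ifs with h
  · have : (x : ℝ) ≤ b := by exact_mod_cast h
    exact div_nonneg (by linarith) (by linarith)
  · have : (b : ℝ) < x := by exact_mod_cast not_le.1 h
    exact div_nonneg (by linarith) (by linarith)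

lemma one_le_exitProb {a b c : ℤ} (hab : a < b) (hbc : b < c) {x : ℤ} (hx : ¬ (a < x ∧ x < c)) :
    1 ≤ exitProb a b c x := by
  have h1 : (a : ℝ) < b := by exact_mod_cast hab
  have h2 : (b : ℝ) < c := by exact_mod_cast hbc
  unfold exitProb
  split_ifs with h
  · have : (x : ℝ) ≤ a := by exact_mod_cast (by omega : x ≤ a)
    rw [le_div_iff₀ (by linarith)]
    linarith
  · have : (c : ℝ) ≤ x := by exact_mod_cast (by omega : c ≤ x)
    rw [le_div_iff₀ (by linarith)]
    linarith

lemma exitProb_harmonic {a b c x : ℤ} (hx : x ≠ b) :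
    (exitProb a b c (x + 1) + exitProb a b c (x - 1)) / 2 = exitProb a b c x := by
  unfold exitProb
  rcases lt_or_gt_of_ne hx with h | h
  · rw [if_pos (by omega), if_pos (by omega), if_pos (by omega)]
    push_cast
    ring
  · have h1 : ¬ x + 1 ≤ b := by omega
    have h2 : ¬ x ≤ b := by omega
    simp only [h1, h2, if_false]
    split_ifs with h'
    -- Only here do the neighbours fall on different branches, and both branches vanish at `b`.
    · obtain rfl : x = b + 1 := by omega
      push_cast
      ring
    · push_cast
      ring

/-- The weight with which a jump out of `b` followed by an excursion of length at least `r`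
counts. -/
def excursionWeight (σ : ℤ → ℝ) (a b c : ℤ) (j : ℕ) (r : ℝ) : ℝ≥0∞ :=
  2⁻¹ * ((survive σ a b c j r (b + 1) + ENNReal.ofReal (exitProb a b c (b + 1))) +
    (survive σ a b c j r (b - 1) + ENNReal.ofReal (exitProb a b c (b - 1))))

lemma measurable_excursionWeight (σ : ℤ → ℝ) (a b c : ℤ) (j : ℕ) :
    Measurable (excursionWeight σ a b c j) :=
  (((measurable_survive ..).add measurable_const).add
    ((measurable_survive ..).add measurable_const)).const_mul _

lemma excursionWeight_le_succ (σ : ℤ → ℝ) (a b c : ℤ) (j : ℕ) (r : ℝ) :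
    excursionWeight σ a b c j r ≤ excursionWeight σ a b c (j + 1) r := by
  unfold excursionWeight
  gcongr <;> exact survive_le_succ ..

/-- The contraction factor of the walk killed outside `(a, c)`. -/
def killRate (a c : ℤ) : ℝ := 1 - 1 / ((c : ℝ) - a) ^ 2

lemma killRate_nonneg {a c : ℤ} (hac : a < c) : 0 ≤ killRate a c := by
  have h : (1 : ℝ) ≤ (c : ℝ) - a := by
    have : (a : ℝ) + 1 ≤ c := by exact_mod_cast hac
    linarith
  rw [killRate, sub_nonneg, div_le_one (by positivity)]
  nlinarith

lemma killRate_lt_one {a c : ℤ} (hac : a < c) : killRate a c < 1 := by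
  have h : (0 : ℝ) < (c : ℝ) - a := by
    have : (a : ℝ) < c := by exact_mod_cast hac
    linarith
  have : 0 < 1 / ((c : ℝ) - a) ^ 2 := by positivity
  rw [killRate]
  linarith

/-- A supersolution for the probability to be off `b`, before capping at `1`. -/
def super (σ : ℤ → ℝ) (a b c : ℤ) (j : ℕ) (s : ℝ) (x : ℤ) : ℝ≥0∞ :=
  (survive σ a b c j s x + ENNReal.ofReal (exitProb a b c x)) +
    (cumul (σ b) (excursionWeight σ a b c j) s +
      ENNReal.ofReal (killRate a c ^ j * (((x : ℝ) - a) * (c - x))))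

lemma measurable_cumul (a : ℝ) (F : ℝ → ℝ≥0∞) : Measurable (cumul a F) :=
  (monotone_cumul a F).measurable

/-- Averaging `(y - a) * (c - y)` over the neighbours of `x` lowers it by exactly `1`, which is at
least the fraction `1 / (c - a) ^ 2` of its value. -/
lemma step_kill_le (σ : ℤ → ℝ) {a c x : ℤ} (hx : a < x ∧ x < c) (j : ℕ) (s : ℝ) :
    step σ (fun _ y => ENNReal.ofReal (killRate a c ^ j * (((y : ℝ) - a) * (c - y)))) s x ≤
      ENNReal.ofReal (killRate a c ^ (j + 1) * (((x : ℝ) - a) * (c - x))) := by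
  have h1 : (a : ℝ) + 1 ≤ x := by exact_mod_cast hx.1
  have h2 : (x : ℝ) + 1 ≤ c := by exact_mod_cast hx.2
  have hk : 0 ≤ killRate a c := killRate_nonneg (hx.1.trans hx.2)
  have hkj : 0 ≤ killRate a c ^ j := pow_nonneg hk j
  refine (step_space_only_le σ _ s x).trans ?_
  rw [inv_two_mul_ofReal_add]
  · refine ENNReal.ofReal_le_ofReal ?_
    have h3 : ((x : ℝ) - a) * (c - x) ≤ ((c : ℝ) - a) ^ 2 := by nlinarith
    have h4 : 1 / ((c : ℝ) - a) ^ 2 * (((x : ℝ) - a) * (c - x)) ≤ 1 := by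
      rw [one_div_mul_eq_div, div_le_one (by nlinarith)]
      exact h3
    rw [pow_succ, mul_assoc, ← mul_add, mul_div_assoc]
    refine mul_le_mul_of_nonneg_left ?_ hkj
    rw [killRate]
    push_cast
    linarith
  · push_cast
    exact mul_nonneg hkj (mul_nonneg (by linarith) (by linarith))
  · push_cast
    exact mul_nonneg hkj (mul_nonneg (by linarith) (by linarith))

lemma step_super (σ : ℤ → ℝ) (a b c : ℤ) (j : ℕ) (s : ℝ) (x : ℤ) :
    step σ (super σ a b c j) s x =
      (step σ (survive σ a b c j) s x +
        step σ (fun _ y => ENNReal.ofReal (exitProb a b c y)) s x) +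
      (hold (σ x) (cumul (σ b) (excursionWeight σ a b c j)) s +
        step σ (fun _ y => ENNReal.ofReal (killRate a c ^ j * (((y : ℝ) - a) * (c - y)))) s x) := by
  unfold super
  rw [step_add σ (fun x => (measurable_survive ..).fun_add measurable_const),
    step_add σ (fun x => measurable_survive ..), step_add σ (fun x => measurable_cumul _ _),
    step_time_only]

/-- At `b` the survival and exit terms of the neighbours form the excursion weight, and the renewal
equation reproduces `cumul`. Off `b` the survival term satisfies its own recursion, the exit term is
harmonic, and `cumul` only loses from having less time left. -/
lemma super_supersolution {σ : ℤ → ℝ} (hσ : ∀ z, 0 < σ z) {a b c : ℤ} (hab : a < b) (hbc : b < c)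
    (j : ℕ) (s : ℝ) {x : ℤ} (hx : a < x ∧ x < c) :
    (if x ≠ b then tail (σ x) s else 0) + step σ (super σ a b c j) s x ≤
      super σ a b c (j + 1) s x := by
  have hcum : cumul (σ b) (excursionWeight σ a b c j) s ≤
      cumul (σ b) (excursionWeight σ a b c (j + 1)) s :=
    cumul_mono _ (excursionWeight_le_succ σ a b c j) s
  rw [step_super]
  by_cases hxb : x = b
  · subst hxb
    have hw : step σ (survive σ a x c j) s x +
        step σ (fun _ y => ENNReal.ofReal (exitProb a x c y)) s x =
        hold (σ x) (excursionWeight σ a x c j) s := by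
      have hm := measurable_survive σ a x c j
      unfold excursionWeight
      rw [hold_const_mul _ _ _ (((hm _).fun_add measurable_const).fun_add ((hm _).fun_add measurable_const)),
        hold_add _ _ ((hm _).fun_add measurable_const), hold_add _ _ (hm _), hold_add _ _ (hm _)]
      unfold step
      ring
    rw [hw, if_neg (by simp), zero_add, ← add_assoc,
      hold_add_hold_cumul (hσ x) (measurable_excursionWeight ..), super]
    calc _ ≤ cumul (σ x) (excursionWeight σ a x c (j + 1)) s +
          ENNReal.ofReal (killRate a c ^ (j + 1) * (((x : ℝ) - a) * (c - x))) :=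
          add_le_add hcum (step_kill_le σ hx j s)
      _ ≤ _ := le_add_self
  · rw [if_pos hxb, super, ← add_assoc (tail _ _), ← add_assoc (tail _ _)]
    refine add_le_add (add_le_add ?_ ?_) (add_le_add ?_ (step_kill_le σ hx j s))
    · rw [survive]
      dsimp only
      rw [if_pos ⟨hx.1, hx.2, hxb⟩]
    · refine (step_space_only_le σ _ s x).trans_eq ?_
      rw [inv_two_mul_ofReal_add (exitProb_nonneg hab hbc _) (exitProb_nonneg hab hbc _),
        exitProb_harmonic hxb]
    · exact (hold_le_of_monotone (hσ x).le (monotone_cumul _ _) s).trans hcum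

/-- Capping at `1` extends the supersolution property beyond `(a, c)`, where the exit term alone is
at least `1`. -/
lemma measure_X_ne_le_super {σ : ℤ → ℝ} (hσ : ∀ z, 0 < σ z) {a b c : ℤ} (hab : a < b) (hbc : b < c)
    {t : ℝ} (ht : 0 ≤ t) (n : ℕ) : noise {w | X σ t w ≠ b} ≤ super σ a b c n t 0 := by
  refine (measure_X_ne_le hσ ht b (fun j s x => min 1 (super σ a b c j s x)) ?_ ?_ ?_ n).trans
    (min_le_right _ _)
  · intro j x
    exact measurable_const.min (((measurable_survive ..).add measurable_const).add
      ((measurable_cumul _ _).add measurable_const))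
  · intro s x _
    refine le_min le_rfl ?_
    by_cases hx : a < x ∧ x < c
    -- Inside the window the quadratic term is a product of two integers, each at least `1`.
    · refine le_trans ?_ (le_trans (le_add_self) (le_add_self (a := _)))
      have h1 : (a : ℝ) + 1 ≤ x := by exact_mod_cast hx.1
      have h2 : (x : ℝ) + 1 ≤ c := by exact_mod_cast hx.2
      rw [ENNReal.one_le_ofReal, pow_zero, one_mul]
      nlinarith
    · refine le_trans (le_trans ?_ (le_add_self)) (le_self_add)
      rw [ENNReal.one_le_ofReal]
      exact one_le_exitProb hab hbc hx
  · intro j s x _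
    have hone : (if x ≠ b then tail (σ x) s else 0) +
        step σ (fun s x => min 1 (super σ a b c j s x)) s x ≤ 1 := by
      refine le_trans (add_le_add ?_ (step_mono σ (fun _ _ => min_le_left _ _) s x))
        (tail_add_step_one σ s x).le
      split_ifs
      · exact le_rfl
      · exact zero_le
    refine le_min hone ?_
    by_cases hx : a < x ∧ x < c
    · exact (add_le_add le_rfl (step_mono σ (fun _ _ => min_le_right _ _) s x)).trans
        (super_supersolution hσ hab hbc j s hx)
    · refine hone.trans (le_trans (le_trans ?_ (le_add_self)) (le_self_add))
      rw [ENNReal.one_le_ofReal]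
      exact one_le_exitProb hab hbc hx

lemma lintegral_excursionWeight_le {σ : ℤ → ℝ} (hσ : ∀ z, 0 < σ z) {a b c : ℤ} (hab : a < b)
    (hbc : b < c) (j : ℕ) {t : ℝ} (ht : 0 ≤ t) :
    ∫⁻ r in Set.Icc 0 t, excursionWeight σ a b c j r ≤
      ENNReal.ofReal (((green σ a b c (b + 1) + exitProb a b c (b + 1) * t) +
        (green σ a b c (b - 1) + exitProb a b c (b - 1) * t)) / 2) := by
  have hm := measurable_survive σ a b c j
  have hg := green_nonneg hσ a b c
  have he := exitProb_nonneg hab hbc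
  have h : ∀ x, ∫⁻ r in Set.Icc 0 t, (survive σ a b c j r x + ENNReal.ofReal (exitProb a b c x)) ≤
      ENNReal.ofReal (green σ a b c x + exitProb a b c x * t) := by
    intro x
    rw [lintegral_add_left (hm x), ENNReal.ofReal_add (hg x) (mul_nonneg (he x) ht),
      ENNReal.ofReal_mul (he x)]
    refine add_le_add (lintegral_Icc_survive_le hσ a b c j t x) ?_
    simp
  unfold excursionWeight
  rw [lintegral_const_mul _ (((hm _).fun_add measurable_const).fun_add ((hm _).fun_add measurable_const)),
    lintegral_add_left ((hm _).fun_add measurable_const),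
    ← inv_two_mul_ofReal_add (add_nonneg (hg _) (mul_nonneg (he _) ht))
      (add_nonneg (hg _) (mul_nonneg (he _) ht))]
  gcongr <;> exact h _

/-- The quenched localisation bound: for `a < b < c`, the chain is at `b` at time `t` up to the
probability to leave `(a, c) \ {b}` at `a` or `c` rather than `b`, and errors controlled by the
total trap depth of `(a, c) \ {b}`. -/
theorem noise_real_X_ne_le {σ : ℤ → ℝ} (hσ : ∀ z, 0 < σ z) {a b c : ℤ} (hab : a < b) (hbc : b < c)
    {t : ℝ} (ht : 0 < t) :
    noise.real {w | X σ t w ≠ b} ≤ exitProb a b c 0 +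
      2 * |(b : ℝ)| * (∑ z ∈ (Finset.Ioo a c).erase b, σ z) / t +
      (σ b)⁻¹ * (2 * (∑ z ∈ (Finset.Ioo a c).erase b, σ z) +
        t / 2 * (1 / ((b : ℝ) - a) + 1 / ((c : ℝ) - b))) := by
  set S := ∑ z ∈ (Finset.Ioo a c).erase b, σ z with hS
  have hg := green_nonneg hσ a b c
  have he := exitProb_nonneg hab hbc
  have hk := killRate_nonneg (hab.trans hbc)
  set B := ((green σ a b c (b + 1) + exitProb a b c (b + 1) * t) +
        (green σ a b c (b - 1) + exitProb a b c (b - 1) * t)) / 2 with hB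
  have hB0 : 0 ≤ B := by
    have := hg (b + 1)
    have := hg (b - 1)
    have := he (b + 1)
    have := he (b - 1)
    positivity
  let K : ℝ := ((0 : ℤ) - (a : ℝ)) * (c - (0 : ℤ))
  have hbound : ∀ n : ℕ, noise.real {w | X σ t w ≠ b} ≤
      (green σ a b c 0 / t + exitProb a b c 0) + ((σ b)⁻¹ * B + killRate a c ^ n * |K|) := by
    intro n
    have hnn : 0 ≤ killRate a c ^ n * |K| := by positivity
    have h1 : 0 ≤ green σ a b c 0 / t := div_nonneg (hg 0) ht.le
    have h2 : 0 ≤ (σ b)⁻¹ * B := mul_nonneg (inv_nonneg.2 (hσ b).le) hB0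
    refine ENNReal.toReal_le_of_le_ofReal (by have := he 0; positivity) ?_
    refine (measure_X_ne_le_super hσ hab hbc ht.le n).trans ?_
    rw [ENNReal.ofReal_add (add_nonneg h1 (he 0)) (add_nonneg h2 hnn),
      ENNReal.ofReal_add h1 (he 0), ENNReal.ofReal_add h2 hnn, super,
      ENNReal.ofReal_mul (inv_nonneg.2 (hσ b).le)]
    gcongr
    · exact survive_le hσ a b c n ht 0
    · unfold cumul
      gcongr
      exact lintegral_excursionWeight_le hσ hab hbc n ht.le
    · exact le_abs_self _
  have hlim : Tendsto (fun n : ℕ => (green σ a b c 0 / t + exitProb a b c 0) +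
      ((σ b)⁻¹ * B + killRate a c ^ n * |K|)) atTop
      (𝓝 ((green σ a b c 0 / t + exitProb a b c 0) + ((σ b)⁻¹ * B + 0 * |K|))) :=
    (((tendsto_pow_atTop_nhds_zero_of_lt_one hk (killRate_lt_one (hab.trans hbc))).mul_const
      _).const_add _).const_add _
  -- The number `n` of jumps is arbitrary, and only the geometric term depends on it.
  refine (ge_of_tendsto' hlim hbound).trans ?_
  have g0 : green σ a b c 0 / t ≤ 2 * |(b : ℝ)| * S / t := by
    gcongr
    simpa using green_le hσ a b c 0
  -- An excursion starts at distance `1` from `b`, so its mean length carries no factor `|b|`.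
  have g1 : green σ a b c (b + 1) ≤ 2 * S := by simpa using green_le hσ a b c (b + 1)
  have g2 : green σ a b c (b - 1) ≤ 2 * S := by simpa using green_le hσ a b c (b - 1)
  have e1 : exitProb a b c (b + 1) = 1 / ((c : ℝ) - b) := by
    rw [exitProb, if_neg (by omega)]
    push_cast
    ring
  have e2 : exitProb a b c (b - 1) = 1 / ((b : ℝ) - a) := by
    rw [exitProb, if_pos (by omega)]
    push_cast
    ring
  have hBle : B ≤ 2 * S + t / 2 * (1 / ((b : ℝ) - a) + 1 / ((c : ℝ) - b)) := by
    rw [hB, e1, e2]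
    linarith
  have := mul_le_mul_of_nonneg_left hBle (inv_nonneg.2 (hσ b).le)
  linarith

/-! ### Slowly varying tails -/

section Tail

variable {Ω : Type*} [MeasurableSpace Ω] {μ : Measure Ω} {Y : Ω → ℝ}

lemma one_div_invTail (x : ℝ) : 1 / invTail μ Y x = μ.real {ω | x < Y ω} := by
  rw [invTail, one_div_one_div]

variable [IsProbabilityMeasure μ]

lemma measureReal_tail_anti {x y : ℝ} (h : x ≤ y) :
    μ.real {ω | y < Y ω} ≤ μ.real {ω | x < Y ω} :=
  measureReal_mono fun _ hω => lt_of_le_of_lt h hω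

lemma measureReal_tail_pos (hL : SlowlyVarying (invTail μ Y)) (x : ℝ) :
    0 < μ.real {ω | x < Y ω} := by
  refine measureReal_nonneg.lt_of_ne' fun h0 => ?_
  have h1 := hL 1 one_pos
  have h2 : (fun u : ℝ => invTail μ Y (u * 1) / invTail μ Y u) =ᶠ[atTop] fun _ => 0 := by
    filter_upwards [eventually_ge_atTop x] with u hu
    have : μ.real {ω | u < Y ω} = 0 :=
      le_antisymm ((measureReal_tail_anti hu).trans h0.le) measureReal_nonneg
    simp [invTail, this]
  exact zero_ne_one (tendsto_nhds_unique (tendsto_const_nhds.congr' h2.symm) h1)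

lemma one_le_invTail (hL : SlowlyVarying (invTail μ Y)) (x : ℝ) : 1 ≤ invTail μ Y x := by
  rw [invTail, le_div_iff₀ (measureReal_tail_pos hL x), one_mul]
  exact measureReal_le_one

lemma invTail_pos (hL : SlowlyVarying (invTail μ Y)) (x : ℝ) : 0 < invTail μ Y x :=
  one_pos.trans_le (one_le_invTail hL x)

lemma monotone_invTail (hL : SlowlyVarying (invTail μ Y)) : Monotone (invTail μ Y) := fun _ y h =>
  one_div_le_one_div_of_le (measureReal_tail_pos hL y) (measureReal_tail_anti h)

lemma tendsto_invTail (hY : Measurable Y) (hL : SlowlyVarying (invTail μ Y)) :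
    Tendsto (invTail μ Y) atTop atTop := by
  have : IsProbabilityMeasure (μ.map Y) := Measure.isProbabilityMeasure_map hY.aemeasurable
  have h1 : Tendsto (fun x => 1 - cdf (μ.map Y) x) atTop (𝓝 (1 - 1)) :=
    (tendsto_cdf_atTop _).const_sub 1
  have h2 : ∀ x, 1 - cdf (μ.map Y) x = μ.real {ω | x < Y ω} := by
    intro x
    rw [cdf_eq_real, ← probReal_compl_eq_one_sub measurableSet_Iic,
      map_measureReal_apply hY measurableSet_Iic.compl]
    congr 1
    ext ω
    simp
  simp only [h2, sub_self] at h1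
  have h3 : Tendsto (fun x => μ.real {ω | x < Y ω}) atTop (𝓝[>] 0) :=
    tendsto_nhdsWithin_iff.2 ⟨h1, Eventually.of_forall fun x => measureReal_tail_pos hL x⟩
  refine (tendsto_inv_nhdsGT_zero.comp h3).congr fun x => ?_
  simp [invTail]

lemma mul_invTail_le_mul_invTail (hL : SlowlyVarying (invTail μ Y)) {x y : ℝ} (hx : 0 ≤ x)
    (hxy : x ≤ y) : x * invTail μ Y x ≤ y * invTail μ Y y :=
  mul_le_mul hxy (monotone_invTail hL hxy) (invTail_pos hL x).le (hx.trans hxy)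

lemma tendsto_level (hL : SlowlyVarying (invTail μ Y)) :
    Tendsto (level (invTail μ Y)) atTop atTop := by
  refine tendsto_atTop.2 fun x => ?_
  filter_upwards [eventually_gt_atTop (max x 0 * invTail μ Y (max x 0)), eventually_ge_atTop 0]
    with t ht ht0
  refine (le_max_left x 0).trans (le_csInf ⟨t, ht0, ?_⟩ fun s hs => ?_)
  · nlinarith [one_le_invTail hL t]
  · by_contra! hlt
    have := mul_invTail_le_mul_invTail hL hs.1 hlt.le
    linarith [hs.2]

/-- The infimum need not be attained: `l / 2` lies below the set, some element lies below `2 * l`,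
and slow variation costs a further factor of at most `2` each way. -/
lemma level_bounds (hL : SlowlyVarying (invTail μ Y)) :
    ∀ᶠ t in atTop, level (invTail μ Y) t * invTail μ Y (level (invTail μ Y) t) / 4 ≤ t ∧
      t ≤ 4 * (level (invTail μ Y) t * invTail μ Y (level (invTail μ Y) t)) := by
  have h1 := (tendsto_level hL).eventually ((hL 2 two_pos).eventually (gt_mem_nhds one_lt_two))
  have h2 := (tendsto_level hL).eventually
    ((hL (1 / 2) (by norm_num)).eventually (lt_mem_nhds (show (1 / 2 : ℝ) < 1 by norm_num)))
  filter_upwards [h1, h2, (tendsto_level hL).eventually_gt_atTop 0, eventually_ge_atTop 0]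
    with t h1 h2 hpos ht0
  set l := level (invTail μ Y) t with hl
  rw [div_lt_iff₀ (invTail_pos hL l)] at h1
  rw [lt_div_iff₀ (invTail_pos hL l)] at h2
  have hbdd : BddBelow {s : ℝ | 0 ≤ s ∧ t ≤ s * invTail μ Y s} := ⟨0, fun s hs => hs.1⟩
  have hne : {s : ℝ | 0 ≤ s ∧ t ≤ s * invTail μ Y s}.Nonempty :=
    ⟨t, ht0, by nlinarith [one_le_invTail hL t]⟩
  constructor
  · have : ¬ (0 ≤ l * (1 / 2) ∧ t ≤ l * (1 / 2) * invTail μ Y (l * (1 / 2))) := by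
      intro h
      have : l ≤ l * (1 / 2) := csInf_le hbdd h
      linarith
    have h3 : l * (1 / 2) * invTail μ Y (l * (1 / 2)) < t := by
      by_contra! h
      exact this ⟨by linarith, h⟩
    nlinarith
  · obtain ⟨s, hs, hs2⟩ := exists_lt_of_csInf_lt hne (show level (invTail μ Y) t < l * 2 by linarith)
    have := mul_invTail_le_mul_invTail hL hs.1 hs2.le
    nlinarith [hs.2]

/-- Truncation of a non-negative real to `(0, u]`. -/
def trunc (u y : ℝ) : ℝ := if 0 < y ∧ y ≤ u then y else 0

lemma trunc_nonneg (u y : ℝ) : 0 ≤ trunc u y := by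
  unfold trunc
  split_ifs with h
  · exact h.1.le
  · exact le_rfl

lemma trunc_le {u : ℝ} (hu : 0 ≤ u) (y : ℝ) : trunc u y ≤ u := by
  unfold trunc
  split_ifs with h
  · exact h.2
  · exact hu

lemma measurable_trunc (u : ℝ) : Measurable (trunc u) :=
  Measurable.ite (measurableSet_Ioc (a := 0) (b := u)) measurable_id measurable_const

lemma integrable_trunc (hY : Measurable Y) {u : ℝ} (hu : 0 ≤ u) :
    Integrable (fun ω => trunc u (Y ω)) μ := by
  refine Integrable.of_bound ((measurable_trunc u).comp hY).aestronglyMeasurable u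
    (Eventually.of_forall fun ω => ?_)
  rw [Real.norm_of_nonneg (trunc_nonneg _ _)]
  exact trunc_le hu _

lemma measureReal_Ioc (hY : Measurable Y) {x y : ℝ} (h : x ≤ y) :
    μ.real {ω | x < Y ω ∧ Y ω ≤ y} = μ.real {ω | x < Y ω} - μ.real {ω | y < Y ω} := by
  have hsub : {ω | y < Y ω} ⊆ {ω | x < Y ω} := fun ω hω => lt_of_le_of_lt h hω
  rw [← measureReal_sdiff hsub (measurableSet_lt measurable_const hY)]
  congr 1
  ext ω
  simp

lemma integral_trunc_two_mul_le (hY : Measurable Y) {u : ℝ} (hu : 0 ≤ u) :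
    ∫ ω, trunc (2 * u) (Y ω) ∂μ ≤
      ∫ ω, trunc u (Y ω) ∂μ + 2 * u * (μ.real {ω | u < Y ω} - μ.real {ω | 2 * u < Y ω}) := by
  have hms : MeasurableSet {ω | u < Y ω ∧ Y ω ≤ 2 * u} := hY measurableSet_Ioc
  have hint : Integrable (fun ω => 2 * u * {ω | u < Y ω ∧ Y ω ≤ 2 * u}.indicator (1 : Ω → ℝ) ω) μ :=
    ((integrable_const (1 : ℝ)).indicator hms).const_mul _
  rw [← measureReal_Ioc hY (by linarith), ← integral_indicator_one hms, ← integral_const_mul,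
    ← integral_add (integrable_trunc hY hu) hint]
  refine integral_mono (integrable_trunc hY (by linarith))
    ((integrable_trunc hY hu).add hint) fun ω => ?_
  simp only [trunc, Set.indicator, Set.mem_ofPred_eq, Pi.one_apply]
  split_ifs <;> grind

/-- The truncated mean of a slowly varying tail is negligible. -/
lemma tendsto_invTail_mul_integral_trunc (hY : Measurable Y) (hL : SlowlyVarying (invTail μ Y)) :
    Tendsto (fun u => invTail μ Y u * (∫ ω, trunc u (Y ω) ∂μ) / u) atTop (𝓝 0) := by
  set I : ℝ → ℝ := fun u => invTail μ Y u * (∫ ω, trunc u (Y ω) ∂μ) / u with hI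
  have hI0 : ∀ u, 0 ≤ u → 0 ≤ I u := fun u hu =>
    div_nonneg (mul_nonneg (invTail_pos hL u).le (integral_nonneg fun ω => trunc_nonneg _ _)) hu
  rw [Metric.tendsto_atTop]
  intro ε hε
  obtain ⟨κ, hκ, hκ1, hκε⟩ : ∃ κ : ℝ, 0 < κ ∧ κ ≤ 1 / 2 ∧ 4 * κ ≤ ε / 4 :=
    ⟨min (1 / 2) (ε / 16), by positivity, min_le_left _ _, by
      have := min_le_right (1 / 2) (ε / 16)
      linarith⟩
  obtain ⟨u₁, hu₁⟩ := eventually_atTop.1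
    ((hL 2 two_pos).eventually (gt_mem_nhds (show (1 : ℝ) < 1 + κ by linarith)))
  set u₀ := max u₁ 1 with hu₀
  have hu₀1 : 1 ≤ u₀ := le_max_right _ _
  -- Doubling `u` halves `I` up to the factor `1 + κ`, and the mass in `(u, 2u]` adds at most `L(2u)
  -- / L(u) - 1 ≤ κ`. The fixed point of the recursion is `4 * κ`.
  have hrec : ∀ u, u₀ ≤ u → I (2 * u) ≤ 3 / 4 * I u + κ := by
    intro u hu
    have hupos : 0 < u := by linarith
    have hr := hu₁ u ((le_max_left _ _).trans hu)
    rw [div_lt_iff₀ (invTail_pos hL u), mul_comm u 2] at hr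
    have hm := integral_trunc_two_mul_le (μ := μ) hY hupos.le
    have h0 : 0 ≤ ∫ ω, trunc u (Y ω) ∂μ := integral_nonneg fun ω => trunc_nonneg _ _
    rw [← one_div_invTail (μ := μ) (Y := Y) u, ← one_div_invTail (μ := μ) (Y := Y) (2 * u)] at hm
    have hLu := invTail_pos hL u
    have hLu2 := invTail_pos hL (2 * u)
    calc I (2 * u) ≤ invTail μ Y (2 * u) * (∫ ω, trunc u (Y ω) ∂μ +
          2 * u * (1 / invTail μ Y u - 1 / invTail μ Y (2 * u))) / (2 * u) := by
          simp only [hI]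
          gcongr
      _ = invTail μ Y (2 * u) * (∫ ω, trunc u (Y ω) ∂μ) / (2 * u) +
          (invTail μ Y (2 * u) / invTail μ Y u - 1) := by
          field_simp
      _ ≤ ((1 + κ) * invTail μ Y u) * (∫ ω, trunc u (Y ω) ∂μ) / (2 * u) + κ := by
          gcongr
          rw [sub_le_iff_le_add, div_le_iff₀ hLu]
          linarith
      _ = (1 + κ) / 2 * I u + κ := by
          simp only [hI]
          field_simp
      _ ≤ _ := by
          have := hI0 u hupos.le
          nlinarith
  -- On the first dyadic block `I u ≤ L(u) ≤ L(2 * u₀)`, since the truncated mean is at most `u`.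
  have hblock : ∀ k : ℕ, ∀ u, 2 ^ k * u₀ ≤ u → u ≤ 2 ^ (k + 1) * u₀ →
      I u ≤ (3 / 4) ^ k * invTail μ Y (2 * u₀) + 4 * κ := by
    intro k
    induction k with
    | zero =>
      intro u h1 h2
      norm_num at h1 h2
      have hupos : 0 < u := by linarith
      have : ∫ ω, trunc u (Y ω) ∂μ ≤ u := by
        refine (integral_mono (integrable_trunc hY hupos.le) (integrable_const u)
          fun ω => trunc_le hupos.le _).trans ?_
        simp
      have h3 : I u ≤ invTail μ Y u := by
        simp only [hI]
        rw [div_le_iff₀ hupos]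
        exact mul_le_mul_of_nonneg_left this (invTail_pos hL u).le
      have h4 := monotone_invTail hL (show u ≤ 2 * u₀ by linarith)
      simp only [pow_zero, one_mul]
      linarith
    | succ k ih =>
      intro u h1 h2
      rw [pow_succ] at h1 h2
      have h3 := ih (u / 2) (by linarith) (by linarith)
      have h4 : u₀ ≤ u / 2 := by
        have : (1 : ℝ) ≤ 2 ^ k := one_le_pow₀ one_le_two
        nlinarith
      have h5 := hrec (u / 2) h4
      rw [mul_div_cancel₀ u two_ne_zero] at h5
      rw [pow_succ]
      linarith
  have hB := invTail_pos hL (2 * u₀)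
  obtain ⟨k₀, hk₀⟩ := exists_pow_lt_of_lt_one (show 0 < ε / 4 / invTail μ Y (2 * u₀) by positivity)
    (show (3 / 4 : ℝ) < 1 by norm_num)
  rw [lt_div_iff₀ hB] at hk₀
  refine ⟨2 ^ k₀ * u₀, fun u hu => ?_⟩
  have hk0 : (1 : ℝ) ≤ 2 ^ k₀ := one_le_pow₀ one_le_two
  have hu1 : u₀ ≤ u := by nlinarith
  obtain ⟨k, hk1, hk2⟩ := exists_nat_pow_near
    (show 1 ≤ u / u₀ by rw [le_div_iff₀ (by linarith)]; linarith) one_lt_two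
  rw [le_div_iff₀ (by linarith)] at hk1
  rw [div_lt_iff₀ (by linarith)] at hk2
  have hkk : k₀ ≤ k := by
    by_contra! hlt
    have : (2 : ℝ) ^ (k + 1) ≤ 2 ^ k₀ := pow_le_pow_right₀ one_le_two hlt
    nlinarith
  have h1 := hblock k u hk1 hk2.le
  have h2 : (3 / 4 : ℝ) ^ k ≤ (3 / 4) ^ k₀ :=
    pow_le_pow_of_le_one (by norm_num) (by norm_num) hkk
  rw [Real.dist_eq, sub_zero, abs_of_nonneg (hI0 u (by linarith))]
  have := mul_le_mul_of_nonneg_right h2 hB.le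
  linarith

end Tail

/-! ### Typical landscapes -/

/-- The integers of absolute value at most `r`. -/
def box (r : ℝ) : Finset ℤ := Finset.Icc (-⌊r⌋) ⌊r⌋

lemma mem_box {r : ℝ} {z : ℤ} : z ∈ box r ↔ |(z : ℝ)| ≤ r := by
  rw [box, Finset.mem_Icc, abs_le, Int.le_floor, neg_le, Int.le_floor, neg_le (a := r)]
  push_cast
  rfl

lemma card_box_le {r : ℝ} (hr : 0 ≤ r) : ((box r).card : ℝ) ≤ 2 * r + 1 := by
  have h0 : 0 ≤ ⌊r⌋ := Int.floor_nonneg.2 hr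
  have h1 : ((box r).card : ℤ) = 2 * ⌊r⌋ + 1 := by
    rw [box, Int.card_Icc]
    omega
  have h2 : ((box r).card : ℝ) = 2 * (⌊r⌋ : ℝ) + 1 := by exact_mod_cast h1
  rw [h2]
  linarith [Int.floor_le r]

/-- The landscapes for which two-site localisation holds at the scales `l` (depth) and `N`
(distance), with constants `C`, `d`, `η`, `M`. -/
structure Typical (C d η M l N : ℝ) (s : ℤ → ℝ) : Prop where
  pos : ∀ z, 0 < s z
  exists_pos : ∃ z : ℤ, 0 < z ∧ (z : ℝ) ≤ C * N ∧ l < s z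
  exists_neg : ∃ z : ℤ, z < 0 ∧ -(C * N) ≤ (z : ℝ) ∧ l < s z
  shallow_near_zero : ∀ z ∈ box (d * N), s z ≤ l
  deep : ∀ z ∈ box (2 * C * N), l < s z → M * l < s z
  separated : ∀ z ∈ box (2 * C * N), ∀ k ∈ (box (d * N)).erase 0, l < s z → s (z + k) ≤ l
  sum_le : ∑ z ∈ box (2 * C * N), trunc l (s z) ≤ η * l

/-- The error in two-site localisation. -/
def locError (C d η M : ℝ) : ℝ := 8 * C * η + (2 * η + 8 / d) / M

/-- All traps of the window other than `b` are shallow, so their total depth is at most `η * l`.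
Reaching `b` then costs `8 * C * η`, excursions cost `2 * η / M`, and leaving the window from `b`
costs `8 / (d * M)`. -/
lemma Typical.X_ne_le {C d η M l N t : ℝ} {s : ℤ → ℝ} (h : Typical C d η M l N s)
    (hC : 0 < C) (hd : 0 < d) (hη : 0 < η) (hM : 0 < M) (hl : 0 < l) (hN : 0 < N)
    (ht : l * N / 4 ≤ t) (ht' : t ≤ 4 * (l * N)) {a b c : ℤ} (hab : d * N / 2 ≤ (b : ℝ) - a)
    (hbc : d * N / 2 ≤ (c : ℝ) - b) (hb : |(b : ℝ)| ≤ C * N) (hbl : l < s b)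
    (ha : -(2 * C * N) ≤ a) (hc : c ≤ 2 * C * N)
    (hs : ∀ z, a < z → z < c → z ≠ b → s z ≤ l) :
    noise.real {w | X s t w ≠ b} ≤ exitProb a b c 0 + locError C d η M := by
  have hdN : 0 < d * N := by positivity
  have hab' : a < b := by
    have : (a : ℝ) < b := by linarith
    exact_mod_cast this
  have hbc' : b < c := by
    have : (b : ℝ) < c := by linarith
    exact_mod_cast this
  have htpos : 0 < t := lt_of_lt_of_le (by positivity) ht
  have hS : ∑ z ∈ (Finset.Ioo a c).erase b, s z ≤ η * l := by
    refine le_trans ?_ h.sum_le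
    calc ∑ z ∈ (Finset.Ioo a c).erase b, s z = ∑ z ∈ (Finset.Ioo a c).erase b, trunc l (s z) := by
          refine Finset.sum_congr rfl fun z hz => ?_
          simp only [Finset.mem_erase, Finset.mem_Ioo] at hz
          rw [trunc, if_pos ⟨h.pos z, hs z hz.2.1 hz.2.2 hz.1⟩]
      _ ≤ _ := by
          refine Finset.sum_le_sum_of_subset_of_nonneg (fun z hz => ?_) fun _ _ _ => trunc_nonneg _ _
          simp only [Finset.mem_erase, Finset.mem_Ioo] at hz
          have h1 : (a : ℝ) < z := by exact_mod_cast hz.2.1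
          have h2 : (z : ℝ) < c := by exact_mod_cast hz.2.2
          rw [mem_box, abs_le]
          constructor <;> linarith
  have hS0 : 0 ≤ ∑ z ∈ (Finset.Ioo a c).erase b, s z := Finset.sum_nonneg fun z _ => (h.pos z).le
  have hdeep : M * l < s b := h.deep b (mem_box.2 (hb.trans (by nlinarith))) hbl
  refine (noise_real_X_ne_le h.pos hab' hbc' htpos).trans ?_
  rw [add_assoc]
  refine add_le_add le_rfl (add_le_add ?_ ?_)
  · rw [div_le_iff₀ htpos]
    calc 2 * |(b : ℝ)| * ∑ z ∈ (Finset.Ioo a c).erase b, s z ≤ 2 * (C * N) * (η * l) := by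
          gcongr
      _ = 8 * C * η * (l * N / 4) := by ring
      _ ≤ _ := by gcongr
  · have h1 : 0 < 1 / ((b : ℝ) - a) := one_div_pos.2 (by linarith)
    have h2 : 0 < 1 / ((c : ℝ) - b) := one_div_pos.2 (by linarith)
    calc (s b)⁻¹ * (2 * (∑ z ∈ (Finset.Ioo a c).erase b, s z) +
          t / 2 * (1 / ((b : ℝ) - a) + 1 / ((c : ℝ) - b)))
        ≤ (M * l)⁻¹ * (2 * (η * l) + 4 * (l * N) / 2 * (1 / (d * N / 2) + 1 / (d * N / 2))) := by
          gcongr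
      _ = (2 * η + 8 / d) / M := by
          field_simp
          ring

/-- Two-site localisation in a typical landscape. -/
theorem Typical.localisation {C d η M l N t : ℝ} {s : ℤ → ℝ} (h : Typical C d η M l N s)
    (hC : 1 ≤ C) (hd : 0 < d) (hd1 : d ≤ 1) (hη : 0 < η) (hM : 0 < M) (hl : 0 < l) (hN : 1 ≤ d * N)
    (ht : l * N / 4 ≤ t) (ht' : t ≤ 4 * (l * N)) :
    |quenchedProb s t (posSite s l) + |(posSite s l : ℝ)| / ∑ z ∈ locSet s l, |(z : ℝ)| - 1| ≤
        locError C d η M ∧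
      |quenchedProb s t (negSite s l) + |(negSite s l : ℝ)| / ∑ z ∈ locSet s l, |(z : ℝ)| - 1| ≤
        locError C d η M := by
  have hN0 : 0 < N := by
    by_contra! h0
    nlinarith
  have hdC : d * N ≤ C * N := by gcongr; linarith
  -- the two sites
  obtain ⟨z₁, hz₁, hz₁C, hz₁l⟩ := h.exists_pos
  obtain ⟨z₂, hz₂, hz₂C, hz₂l⟩ := h.exists_neg
  have hbd₁ : BddBelow {z : ℤ | 0 < z ∧ l < s z} := ⟨0, fun z hz => hz.1.le⟩
  have hbd₂ : BddAbove {z : ℤ | z < 0 ∧ l < s z} := ⟨0, fun z hz => hz.1.le⟩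
  have hne₁ : {z : ℤ | 0 < z ∧ l < s z}.Nonempty := ⟨z₁, hz₁, hz₁l⟩
  have hne₂ : {z : ℤ | z < 0 ∧ l < s z}.Nonempty := ⟨z₂, hz₂, hz₂l⟩
  have hmem₁ : 0 < posSite s l ∧ l < s (posSite s l) := Int.csInf_mem hne₁ hbd₁
  have hmem₂ : negSite s l < 0 ∧ l < s (negSite s l) := Int.csSup_mem hne₂ hbd₂
  have hle₁ : ∀ z, 0 < z → l < s z → posSite s l ≤ z := fun z h1 h2 =>
    csInf_le hbd₁ (show z ∈ {z : ℤ | 0 < z ∧ l < s z} from ⟨h1, h2⟩)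
  have hle₂ : ∀ z, z < 0 → l < s z → z ≤ negSite s l := fun z h1 h2 =>
    le_csSup hbd₂ (show z ∈ {z : ℤ | z < 0 ∧ l < s z} from ⟨h1, h2⟩)
  have hsum : ∑ z ∈ locSet s l, |(z : ℝ)| = |(posSite s l : ℝ)| + |(negSite s l : ℝ)| := by
    rw [locSet, Finset.sum_pair (by omega)]
  rw [hsum]
  set p := posSite s l
  set q := negSite s l
  have hpC : (p : ℝ) ≤ C * N := by
    have : (p : ℝ) ≤ z₁ := by exact_mod_cast hle₁ z₁ hz₁ hz₁l
    linarith
  have hqC : -(C * N) ≤ (q : ℝ) := by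
    have : (z₂ : ℝ) ≤ q := by exact_mod_cast hle₂ z₂ hz₂ hz₂l
    linarith
  have hp0 : (0 : ℝ) < p := by exact_mod_cast hmem₁.1
  have hq0 : (q : ℝ) < 0 := by exact_mod_cast hmem₂.1
  have hpd : d * N < p := by
    by_contra! hle
    have := h.shallow_near_zero p (mem_box.2 (by rwa [abs_of_pos hp0]))
    linarith [hmem₁.2]
  have hqd : (q : ℝ) < -(d * N) := by
    by_contra! hle
    have := h.shallow_near_zero q (mem_box.2 (by rw [abs_of_neg hq0]; linarith))
    linarith [hmem₂.2]
  have hs0 : s 0 ≤ l := h.shallow_near_zero 0 (mem_box.2 (by simp; positivity))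
  have hin : ∀ z, q < z → z < p → s z ≤ l := by
    intro z h1 h2
    by_contra! hlt
    rcases lt_trichotomy z 0 with h0 | h0 | h0
    · exact absurd (hle₂ z h0 hlt) (not_le.2 h1)
    · rw [h0] at hlt
      linarith
    · exact absurd (hle₁ z h0 hlt) (not_le.2 h2)
  -- the window beyond each site
  set r := ⌊d * N⌋ with hr
  have hr1 : (1 : ℝ) ≤ r := by exact_mod_cast Int.le_floor.2 (by simpa using hN)
  have hrle : (r : ℝ) ≤ d * N := Int.floor_le _
  -- Since `r ≥ 1`, `d * N < r + 1 ≤ 2 * r`.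
  have hrge : d * N / 2 ≤ r := by
    have := Int.lt_floor_add_one (d * N)
    rw [← hr] at this
    linarith
  have hsep : ∀ b : ℤ, |(b : ℝ)| ≤ C * N → l < s b → ∀ z : ℤ, z ≠ b → |(z : ℝ) - b| ≤ r → s z ≤ l := by
    intro b hb hbl z hz hzb
    have := h.separated b (mem_box.2 (hb.trans (by nlinarith))) (z - b)
      (Finset.mem_erase.2 ⟨sub_ne_zero.2 hz, mem_box.2 (by push_cast; linarith)⟩) hbl
    rwa [add_sub_cancel] at this
  have hpabs : |(p : ℝ)| ≤ C * N := by rwa [abs_of_pos hp0]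
  have hqabs : |(q : ℝ)| ≤ C * N := by rw [abs_of_neg hq0]; linarith
  -- One end of the window is the competing site, so the exit probability from `0` is exactly the
  -- ruin probability. The other end only gives `b` room, kept free of deep traps by separation.
  have hP := h.X_ne_le (a := q) (b := p) (c := p + r) (by linarith) hd hη hM hl hN0 ht ht'
    (by linarith) (by push_cast; linarith) hpabs hmem₁.2 (by linarith)
    (by push_cast; linarith) (by
      intro z h1 h2 h3
      rcases lt_or_gt_of_ne h3 with h4 | h4
      · exact hin z h1 h4
      · refine hsep p hpabs hmem₁.2 z h3 ?_
        have h5 : (p : ℝ) < z := by exact_mod_cast h4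
        have h6 : (z : ℝ) < p + r := by exact_mod_cast h2
        rw [abs_of_pos (by linarith)]
        linarith)
  have hQ := h.X_ne_le (a := q - r) (b := q) (c := p) (by linarith) hd hη hM hl hN0 ht ht'
    (by push_cast; linarith) (by linarith) hqabs hmem₂.2 (by push_cast; linarith)
    (by linarith) (by
      intro z h1 h2 h3
      rcases lt_or_gt_of_ne h3 with h4 | h4
      · refine hsep q hqabs hmem₂.2 z h3 ?_
        have h5 : (z : ℝ) < q := by exact_mod_cast h4
        have h6 : (q : ℝ) - r < z := by exact_mod_cast h1
        rw [abs_of_neg (by linarith)]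
        linarith
      · exact hin z h4 h2)
  have eP : exitProb q p (p + r) 0 = (p : ℝ) / (p - q) := by
    rw [exitProb, if_pos hmem₁.1.le]
    simp
  have eQ : exitProb (q - r) q p 0 = -(q : ℝ) / (p - q) := by
    rw [exitProb, if_neg (not_le.2 hmem₂.1)]
    simp
  rw [eP] at hP
  rw [eQ] at hQ
  -- Subadditivity is enough, and spares the measurability of the event.
  have hcompl : ∀ b : ℤ, 1 ≤ quenchedProb s t b + noise.real {w | X s t w ≠ b} := by
    intro b
    refine le_trans (le_of_eq ?_) (measureReal_union_le _ _)
    rw [← probReal_univ (μ := noise)]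
    congr 1
    ext w
    simp [em]
  have hpq : quenchedProb s t p ≤ noise.real {w | X s t w ≠ q} := by
    refine measureReal_mono fun w hw => ?_
    have hw' : X s t w = p := hw
    show X s t w ≠ q
    omega
  have hqp : quenchedProb s t q ≤ noise.real {w | X s t w ≠ p} := by
    refine measureReal_mono fun w hw => ?_
    have hw' : X s t w = q := hw
    show X s t w ≠ p
    omega
  have h1 := hcompl p
  have h2 := hcompl q
  rw [abs_of_pos hp0, abs_of_neg hq0, ← sub_eq_add_neg]
  have hone : (p : ℝ) / (p - q) + -(q : ℝ) / (p - q) = 1 := by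
    rw [← add_div, ← sub_eq_add_neg, div_self (by linarith)]
  constructor <;> rw [abs_le] <;> constructor <;> linarith

/-! ### Landscapes are typical with high probability -/

section Landscape

variable {Ω : Type*} [MeasurableSpace Ω] {μ : Measure Ω} {σ : ℤ → Ω → ℝ}

lemma measureReal_mem_eq (hident : ∀ z, IdentDistrib (σ z) (σ 0) μ μ) (z : ℤ) {A : Set ℝ}
    (hA : MeasurableSet A) : μ.real {ω | σ z ω ∈ A} = μ.real {ω | σ 0 ω ∈ A} := by
  have := (hident z).measure_mem_eq hA
  simp only [measureReal_def]
  exact congrArg ENNReal.toReal this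

lemma measureReal_lt_eq (hident : ∀ z, IdentDistrib (σ z) (σ 0) μ μ) (z : ℤ) (l : ℝ) :
    μ.real {ω | l < σ z ω} = 1 / invTail μ (σ 0) l := by
  rw [one_div_invTail]
  exact measureReal_mem_eq hident z measurableSet_Ioi

lemma measureReal_exists_mem_le (hident : ∀ z, IdentDistrib (σ z) (σ 0) μ μ) (S : Finset ℤ)
    {A : Set ℝ} (hA : MeasurableSet A) :
    μ.real {ω | ∃ z ∈ S, σ z ω ∈ A} ≤ S.card * μ.real {ω | σ 0 ω ∈ A} := by
  have h : {ω | ∃ z ∈ S, σ z ω ∈ A} = ⋃ z ∈ S, {ω | σ z ω ∈ A} := by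
    ext ω
    simp
  rw [h]
  refine (measureReal_biUnion_finset_le _ _).trans ?_
  simp [measureReal_mem_eq hident _ hA]

lemma measureReal_exists_pair_le (hindep : iIndepFun σ μ)
    (hident : ∀ z, IdentDistrib (σ z) (σ 0) μ μ) (S T : Finset ℤ) (hT : 0 ∉ T) (l : ℝ) :
    μ.real {ω | ∃ z ∈ S, ∃ k ∈ T, l < σ z ω ∧ l < σ (z + k) ω} ≤
      S.card * (T.card * (1 / invTail μ (σ 0) l) ^ 2) := by
  have h : {ω | ∃ z ∈ S, ∃ k ∈ T, l < σ z ω ∧ l < σ (z + k) ω} =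
      ⋃ z ∈ S, ⋃ k ∈ T, {ω | l < σ z ω ∧ l < σ (z + k) ω} := by
    ext ω
    simp only [Set.mem_ofPred_eq, Set.mem_iUnion, exists_prop]
  rw [h]
  refine (measureReal_biUnion_finset_le _ _).trans ?_
  rw [← nsmul_eq_mul]
  refine Finset.sum_le_card_nsmul _ _ _ fun z _ => ?_
  refine (measureReal_biUnion_finset_le _ _).trans ?_
  rw [← nsmul_eq_mul]
  refine Finset.sum_le_card_nsmul _ _ _ fun k hk => ?_
  have hne : z ≠ z + k := by
    rintro h
    have : k = 0 := by omega
    exact hT (this ▸ hk)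
  have h1 := (hindep.indepFun hne).measure_inter_preimage_eq_mul (Set.Ioi l) (Set.Ioi l)
    measurableSet_Ioi measurableSet_Ioi
  have h2 : {ω | l < σ z ω ∧ l < σ (z + k) ω} = σ z ⁻¹' Set.Ioi l ∩ σ (z + k) ⁻¹' Set.Ioi l := by
    ext ω
    simp
  have h3 : ∀ z, (μ (σ z ⁻¹' Set.Ioi l)).toReal = 1 / invTail μ (σ 0) l :=
    fun z => measureReal_lt_eq hident z l
  rw [h2, measureReal_def, h1, ENNReal.toReal_mul, h3, h3, sq]

variable [IsProbabilityMeasure μ]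

lemma measureReal_forall_le_le (hmeas : ∀ z, Measurable (σ z)) (hindep : iIndepFun σ μ)
    (hident : ∀ z, IdentDistrib (σ z) (σ 0) μ μ) (S : Finset ℤ) (l : ℝ) :
    μ.real {ω | ∀ z ∈ S, σ z ω ≤ l} ≤ Real.exp (-(S.card / invTail μ (σ 0) l)) := by
  have h : {ω | ∀ z ∈ S, σ z ω ≤ l} = ⋂ z ∈ S, σ z ⁻¹' Set.Iic l := by
    ext ω
    simp
  have h1 := hindep.measure_inter_preimage_eq_mul S (sets := fun _ => Set.Iic l)
    fun _ _ => measurableSet_Iic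
  have h2 : ∀ z, (μ (σ z ⁻¹' Set.Iic l)).toReal = 1 - 1 / invTail μ (σ 0) l := by
    intro z
    have hc : σ z ⁻¹' Set.Iic l = {ω | l < σ z ω}ᶜ := by
      ext ω
      simp
    rw [← measureReal_def, hc, probReal_compl_eq_one_sub (measurableSet_lt measurable_const (hmeas z)),
      measureReal_lt_eq hident]
  rw [h, measureReal_def, h1, ENNReal.toReal_prod, Finset.prod_congr rfl fun z _ => h2 z,
    Finset.prod_const, ← mul_one_div (S.card : ℝ), ← mul_neg, Real.exp_nat_mul]
  refine pow_le_pow_left₀ ?_ ?_ _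
  · rw [← h2 0]
    exact ENNReal.toReal_nonneg
  · have := Real.add_one_le_exp (-(1 / invTail μ (σ 0) l))
    linarith

lemma measureReal_sum_trunc_le (hmeas : ∀ z, Measurable (σ z))
    (hident : ∀ z, IdentDistrib (σ z) (σ 0) μ μ) (S : Finset ℤ) {l x : ℝ} (hl : 0 ≤ l) (hx : 0 < x) :
    μ.real {ω | x < ∑ z ∈ S, trunc l (σ z ω)} ≤ S.card * (∫ ω, trunc l (σ 0 ω) ∂μ) / x := by
  rw [le_div_iff₀ hx, mul_comm]
  have hint : ∀ z, Integrable (fun ω => trunc l (σ z ω)) μ := fun z => integrable_trunc (hmeas z) hl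
  have h1 := mul_meas_ge_le_integral_of_nonneg (μ := μ) (f := fun ω => ∑ z ∈ S, trunc l (σ z ω))
    (Eventually.of_forall fun ω => Finset.sum_nonneg fun z _ => trunc_nonneg _ _)
    (integrable_finsetSum _ fun z _ => hint z) x
  have h2 : ∀ z, ∫ ω, trunc l (σ z ω) ∂μ = ∫ ω, trunc l (σ 0 ω) ∂μ := fun z =>
    ((hident z).comp (measurable_trunc l)).integral_eq
  rw [integral_finsetSum _ fun z _ => hint z, Finset.sum_congr rfl fun z _ => h2 z,
    Finset.sum_const, nsmul_eq_mul] at h1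
  refine le_trans (mul_le_mul_of_nonneg_left (measureReal_mono fun ω hω => ?_) hx.le) h1
  exact (show x < ∑ z ∈ S, trunc l (σ z ω) from hω).le

lemma le_card_Ioc_floor {r : ℝ} : r - 1 ≤ ((Finset.Ioc 0 ⌊r⌋).card : ℝ) ∧
    r - 1 ≤ ((Finset.Ico (-⌊r⌋) 0).card : ℝ) := by
  have h2 : ((⌊r⌋ : ℤ) : ℝ) ≤ ((⌊r⌋.toNat : ℤ) : ℝ) := by exact_mod_cast Int.self_le_toNat _
  have h3 := Int.lt_floor_add_one r
  rw [Int.card_Ioc, Int.card_Ico]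
  simp only [sub_zero, sub_neg_eq_add, zero_add]
  push_cast at h2 ⊢
  constructor <;> linarith

/-- Union bound over the fields of `Typical`, with deep traps of density `1 / N`: none among about
`C * N` sites on one side (twice), one near `0`, a pair too close, one in `(l, M * l]`, and Markov's
inequality for the shallow sum. -/
lemma measureReal_not_typical_le (hmeas : ∀ z, Measurable (σ z)) (hpos : ∀ z, ∀ᵐ ω ∂μ, 0 < σ z ω)
    (hindep : iIndepFun σ μ) (hident : ∀ z, IdentDistrib (σ z) (σ 0) μ μ)
    {C d η M l N : ℝ} (hN : N = invTail μ (σ 0) l) (hC : 1 ≤ C) (hd : 0 < d)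
    (hη : 0 < η) (hM : 1 ≤ M) (hl : 0 < l) (hN1 : 1 ≤ N) (hdN : 1 ≤ d * N) :
    μ.real {ω | ¬ Typical C d η M l N fun z => σ z ω} ≤
      2 * Real.exp (1 - C) + (3 * d + 15 * C * d) + 5 * C * (1 - N / invTail μ (σ 0) (M * l)) +
        5 * C / η * (N * (∫ ω, trunc l (σ 0 ω) ∂μ) / l) := by
  have hCN : 1 ≤ C * N := by nlinarith
  have hcardC : ((box (2 * C * N)).card : ℝ) ≤ 5 * C * N := by
    have := card_box_le (show 0 ≤ 2 * C * N by positivity)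
    linarith
  have hcardd : ((box (d * N)).card : ℝ) ≤ 3 * d * N := by
    have := card_box_le (show 0 ≤ d * N by positivity)
    linarith
  have hcardd' : (((box (d * N)).erase 0).card : ℝ) ≤ 3 * d * N :=
    le_trans (by exact_mod_cast Finset.card_le_card (Finset.erase_subset _ _)) hcardd
  have hexp : ∀ S : Finset ℤ, C * N - 1 ≤ S.card →
      μ.real {ω | ∀ z ∈ S, σ z ω ≤ l} ≤ Real.exp (1 - C) := by
    intro S hS
    refine (measureReal_forall_le_le hmeas hindep hident S l).trans (Real.exp_le_exp.2 ?_)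
    rw [← hN]
    have : C - 1 ≤ (S.card : ℝ) / N := by
      rw [le_div_iff₀ (by linarith)]
      linarith
    linarith
  let A0 : Set Ω := {ω | ¬ ∀ z, 0 < σ z ω}
  let A1 : Set Ω := {ω | ∀ z ∈ Finset.Ioc 0 ⌊C * N⌋, σ z ω ≤ l}
  let A2 : Set Ω := {ω | ∀ z ∈ Finset.Ico (-⌊C * N⌋) 0, σ z ω ≤ l}
  let A3 : Set Ω := {ω | ∃ z ∈ box (d * N), σ z ω ∈ Set.Ioi l}
  let A4 : Set Ω := {ω | ∃ z ∈ box (2 * C * N), σ z ω ∈ Set.Ioc l (M * l)}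
  let A5 : Set Ω := {ω | ∃ z ∈ box (2 * C * N), ∃ k ∈ (box (d * N)).erase 0,
    l < σ z ω ∧ l < σ (z + k) ω}
  let A6 : Set Ω := {ω | η * l < ∑ z ∈ box (2 * C * N), trunc l (σ z ω)}
  have b0 : μ.real A0 = 0 := by
    rw [measureReal_eq_zero_iff]
    exact ae_iff.1 (ae_all_iff.2 hpos)
  have b1 : μ.real A1 ≤ Real.exp (1 - C) := hexp _ le_card_Ioc_floor.1
  have b2 : μ.real A2 ≤ Real.exp (1 - C) := hexp _ le_card_Ioc_floor.2
  have b3 : μ.real A3 ≤ 3 * d := by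
    refine (measureReal_exists_mem_le hident _ measurableSet_Ioi).trans ?_
    have : μ.real {ω | σ 0 ω ∈ Set.Ioi l} = 1 / N := by
      rw [hN]
      exact measureReal_lt_eq hident 0 l
    rw [this, mul_one_div, div_le_iff₀ (by linarith)]
    exact hcardd
  have b4 : μ.real A4 ≤ 5 * C * (1 - N / invTail μ (σ 0) (M * l)) := by
    refine (measureReal_exists_mem_le hident _ measurableSet_Ioc).trans ?_
    have h1 : μ.real {ω | σ 0 ω ∈ Set.Ioc l (M * l)} = 1 / N - 1 / invTail μ (σ 0) (M * l) := by
      rw [hN, one_div_invTail, one_div_invTail]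
      exact measureReal_Ioc (hmeas 0) (by nlinarith)
    calc _ ≤ 5 * C * N * μ.real {ω | σ 0 ω ∈ Set.Ioc l (M * l)} := by gcongr
      _ = _ := by
        rw [h1]
        field_simp
  have b5 : μ.real A5 ≤ 15 * C * d := by
    refine (measureReal_exists_pair_le hindep hident _ _ (by simp) l).trans ?_
    rw [← hN]
    calc _ ≤ 5 * C * N * (3 * d * N * (1 / N) ^ 2) := by gcongr
      _ = _ := by
        field_simp
        ring
  have b6 : μ.real A6 ≤ 5 * C / η * (N * (∫ ω, trunc l (σ 0 ω) ∂μ) / l) := by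
    refine (measureReal_sum_trunc_le hmeas hident _ hl.le (mul_pos hη hl)).trans ?_
    have : 0 ≤ ∫ ω, trunc l (σ 0 ω) ∂μ := integral_nonneg fun ω => trunc_nonneg _ _
    calc _ ≤ 5 * C * N * (∫ ω, trunc l (σ 0 ω) ∂μ) / (η * l) := by gcongr
      _ = _ := by
        field_simp
  have hsub : {ω | ¬ Typical C d η M l N fun z => σ z ω} ⊆
      A0 ∪ (A1 ∪ (A2 ∪ (A3 ∪ (A4 ∪ (A5 ∪ A6))))) := by
    intro ω hω
    by_contra hcon
    simp only [Set.mem_union, not_or] at hcon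
    obtain ⟨h0, h1, h2, h3, h4, h5, h6⟩ := hcon
    simp only [A0, A1, A2, A3, A4, A5, A6, Set.mem_ofPred_eq, not_forall, not_exists,
      not_and, not_le, not_lt, Set.mem_Ioi, Set.mem_Ioc] at h0 h1 h2 h3 h4 h5 h6
    refine hω ⟨h0, ?_, ?_, h3, fun z hz hzl => ?_, fun z hz k hk => h5 z hz k hk, h6⟩
    · obtain ⟨z, hz, hzl⟩ := h1
      rw [Finset.mem_Ioc] at hz
      exact ⟨z, hz.1, Int.le_floor.1 hz.2, hzl⟩
    · obtain ⟨z, hz, hzl⟩ := h2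
      rw [Finset.mem_Ico] at hz
      refine ⟨z, hz.2, ?_, hzl⟩
      have := Int.le_floor.1 (neg_le.1 hz.1)
      push_cast at this
      linarith
    · by_contra hle
      exact absurd (h4 z hz hzl) (not_lt.2 (not_lt.1 hle))
  refine (measureReal_mono hsub).trans ?_
  have u0 := measureReal_union_le (μ := μ) A0 (A1 ∪ (A2 ∪ (A3 ∪ (A4 ∪ (A5 ∪ A6)))))
  have u1 := measureReal_union_le (μ := μ) A1 (A2 ∪ (A3 ∪ (A4 ∪ (A5 ∪ A6))))
  have u2 := measureReal_union_le (μ := μ) A2 (A3 ∪ (A4 ∪ (A5 ∪ A6)))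
  have u3 := measureReal_union_le (μ := μ) A3 (A4 ∪ (A5 ∪ A6))
  have u4 := measureReal_union_le (μ := μ) A4 (A5 ∪ A6)
  have u5 := measureReal_union_le (μ := μ) A5 A6
  linarith

/-- With high probability, both localisation errors are small. -/
theorem eventually_measureReal_locError_le (hmeas : ∀ z, Measurable (σ z))
    (hpos : ∀ z, ∀ᵐ ω ∂μ, 0 < σ z ω) (hindep : iIndepFun σ μ)
    (hident : ∀ z, IdentDistrib (σ z) (σ 0) μ μ) (hL : SlowlyVarying (invTail μ (σ 0)))
    {ε δ : ℝ} (hε : 0 < ε) (hδ : 0 < δ) :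
    ∀ᶠ t in atTop, ∃ C d η M N : ℝ,
      μ.real {ω | ¬ Typical C d η M (level (invTail μ (σ 0)) t) N fun z => σ z ω} < δ ∧
      ∀ s : ℤ → ℝ, Typical C d η M (level (invTail μ (σ 0)) t) N s →
        |quenchedProb s t (posSite s (level (invTail μ (σ 0)) t)) +
            |(posSite s (level (invTail μ (σ 0)) t) : ℝ)| /
              ∑ z ∈ locSet s (level (invTail μ (σ 0)) t), |(z : ℝ)| - 1| < ε ∧
        |quenchedProb s t (negSite s (level (invTail μ (σ 0)) t)) +
            |(negSite s (level (invTail μ (σ 0)) t) : ℝ)| /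
              ∑ z ∈ locSet s (level (invTail μ (σ 0)) t), |(z : ℝ)| - 1| < ε := by
  -- The order matters: `d` and `η` depend on `C`, and `M` on `d` and `η`, all before `t` is taken
  -- large. The probabilities use up `δ / 8 + δ / 8 + δ / 4 + δ / 4`, the localisation error `ε / 4
  -- + ε / 4`.
  obtain ⟨C, hC, hCδ⟩ : ∃ C : ℝ, 1 ≤ C ∧ Real.exp (1 - C) < δ / 16 := by
    have h : Tendsto (fun C : ℝ => Real.exp (1 - C)) atTop (𝓝 0) :=
      Real.tendsto_exp_atBot.comp (tendsto_atBot_add_const_left _ 1 tendsto_neg_atTop_atBot)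
    exact ((eventually_ge_atTop 1).and (h.eventually_lt_const (by positivity))).exists
  obtain ⟨d, hd, hd1, hdδ⟩ : ∃ d : ℝ, 0 < d ∧ d ≤ 1 ∧ 18 * C * d ≤ δ / 8 := by
    refine ⟨min 1 (δ / (144 * C)), by positivity, min_le_left _ _, ?_⟩
    calc 18 * C * min 1 (δ / (144 * C)) ≤ 18 * C * (δ / (144 * C)) := by
          gcongr
          exact min_le_right _ _
      _ = δ / 8 := by
          field_simp
          norm_num
  obtain ⟨η, hη, hηε⟩ : ∃ η : ℝ, 0 < η ∧ 8 * C * η = ε / 4 :=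
    ⟨ε / (32 * C), by positivity, by field_simp; norm_num⟩
  obtain ⟨M, hM, hMε⟩ : ∃ M : ℝ, 1 ≤ M ∧ (2 * η + 8 / d) / M ≤ ε / 4 := by
    refine ⟨max 1 ((2 * η + 8 / d) / (ε / 4)), le_max_left _ _, ?_⟩
    rw [div_le_comm₀ (by positivity) (by positivity)]
    exact le_max_right _ _
  have hlev := tendsto_level hL
  have hdeep : Tendsto (fun l => 5 * C * (1 - invTail μ (σ 0) l / invTail μ (σ 0) (M * l))) atTop
      (𝓝 (5 * C * (1 - 1⁻¹))) := by
    refine (((hL M (by linarith)).inv₀ one_ne_zero).congr fun l => ?_).const_sub 1 |>.const_mul _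
    rw [inv_div, mul_comm]
  have hsum : Tendsto (fun l => 5 * C / η * (invTail μ (σ 0) l * (∫ ω, trunc l (σ 0 ω) ∂μ) / l))
      atTop (𝓝 (5 * C / η * 0)) :=
    (tendsto_invTail_mul_integral_trunc (hmeas 0) hL).const_mul _
  rw [inv_one, sub_self, mul_zero] at hdeep
  rw [mul_zero] at hsum
  filter_upwards [level_bounds hL, hlev.eventually_gt_atTop 0,
    hlev.eventually (hdeep.eventually_lt_const (show 0 < δ / 4 by positivity)),
    hlev.eventually (hsum.eventually_lt_const (show 0 < δ / 4 by positivity)),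
    hlev.eventually ((tendsto_invTail (hmeas 0) hL).eventually_ge_atTop (1 / d))]
    with t ht hl h1 h2 hN
  set l := level (invTail μ (σ 0)) t
  rw [div_le_iff₀' hd] at hN
  refine ⟨C, d, η, M, invTail μ (σ 0) l, ?_, fun s hs => ?_⟩
  · have := measureReal_not_typical_le hmeas hpos hindep hident rfl hC hd hη hM hl
      (one_le_invTail hL l) hN
    have hdC : d ≤ C * d := by nlinarith
    linarith
  · have herr : locError C d η M < ε := by
      rw [locError]
      linarith
    have := hs.localisation hC hd hd1 hη (by linarith) hl hN ht.1 ht.2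
    exact ⟨this.1.trans_lt herr, this.2.trans_lt herr⟩

end Landscape

end BTM

end

theorem theorem2 {Ω : Type*} [MeasurableSpace Ω] (μ : Measure Ω) [IsProbabilityMeasure μ]
    (σ : ℤ → Ω → ℝ)
    (hmeas : ∀ z, Measurable (σ z))
    (hpos : ∀ z, ∀ᵐ ω ∂μ, 0 < σ z ω)
    (hindep : iIndepFun σ μ)
    (hident : ∀ z, IdentDistrib (σ z) (σ 0) μ μ)
    (hL : BTM.SlowlyVarying (BTM.invTail μ (σ 0))) :
    let ℓ : ℝ → ℝ := BTM.level (BTM.invTail μ (σ 0))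
    let S : Ω → ℤ → ℝ := fun ω z => σ z ω
    let Z₁ : ℝ → Ω → ℤ := fun t ω => BTM.posSite (S ω) (ℓ t)
    let Z₂ : ℝ → Ω → ℤ := fun t ω => BTM.negSite (S ω) (ℓ t)
    let Γ : ℝ → Ω → Finset ℤ := fun t ω => BTM.locSet (S ω) (ℓ t)
    TendstoInMeasure μ
      (fun (t : ℝ) ω => BTM.quenchedProb (S ω) t (Z₁ t ω)
        + |(Z₁ t ω : ℝ)| / ∑ z ∈ Γ t ω, |(z : ℝ)|)
      atTop (fun _ => (1 : ℝ)) ∧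
    TendstoInMeasure μ
      (fun (t : ℝ) ω => BTM.quenchedProb (S ω) t (Z₂ t ω)
        + |(Z₂ t ω : ℝ)| / ∑ z ∈ Γ t ω, |(z : ℝ)|)
      atTop (fun _ => (1 : ℝ)) := by
  intro ℓ S Z₁ Z₂ Γ
  simp only [tendstoInMeasure_iff_measureReal_norm, Real.norm_eq_abs]
  constructor <;> intro ε hε <;> refine Metric.tendsto_nhds.2 fun δ hδ => ?_ <;>
    filter_upwards [BTM.eventually_measureReal_locError_le hmeas hpos hindep hident hL hε hδ]
      with t ⟨C, d, η, M, N, hprob, hs⟩ <;>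
    rw [Real.dist_eq, sub_zero, abs_of_nonneg measureReal_nonneg] <;>
    refine (measureReal_mono fun ω hω hT => ?_).trans_lt hprob
  · exact absurd (hs _ hT).1 (not_lt.2 hω)
  · exact absurd (hs _ hT).2 (not_lt.2 hω)
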